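/- Let $\mathbf{Fam}(\mathbf{Set})$ be the category whose objects are families $(S_x)_{x\in X}$ of sets indexed by a set $X$, and in which a map $(S_x)_{x\in X}\to(R_y)_{y\in Y}$ is a map of sets $f\colon X\to Y$ together with a map $\varphi_x\colon R_{f(x)}\to S_x$ for each $x\in X$. Let $\mathbf{FinFam}(\mathbf{Set})$ be its full subcategory of families with finite indexing set. A functor $G\colon\mathcal{B}\to\mathcal{A}$ has a codensity monad if for every object $A$ of $\mathcal{A}$ the limit $T^G(A)=\lim_{(B,\,f\colon A\to G(B))}G(B)$, over all pairs of an object $B$ of $\mathcal{B}$ and a map $f\colon A\to G(B)$, exists. Then $T^G$, with its canonical natural transformation $\kappa\colon T^G G\to G$, is the right Kan extension of $G$ along itself, and the codensity monad of $G$ is $T^G$ with the unit $\eta$ and multiplication $\mu$ determined by $\kappa\circ\eta G=\mathrm{id}_G$ and $\kappa\circ\mu G=\kappa\circ T^G\kappa$. Let $\mathbf{CHSheaf}$ be the category whose objects are pairs $(X,S)$ of a compact Hausdorff space $X$ and a sheaf $S$ of sets on $X$, and in which a map $(X,S)\to(Y,R)$ is a continuous map $f\colon X\to Y$ together with a map of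 sheaves $f^*R\to S$ on $X$ (equivalently, a map $R\to f_*S$ of sheaves on $Y$). Then the inclusion $\mathbf{FinFam}(\mathbf{Set})\hookrightarrow\mathbf{Fam}(\mathbf{Set})$ has a codensity monad, and the category of (Eilenberg–Moore) algebras for this monad is equivalent to $\mathbf{CHSheaf}$. -/

import Mathlib

open CategoryTheory CategoryTheory.Limits

universe u

section Codensity

universe v₁ v₂ u₁ u₂

variable {B : Type u₁} [Category.{v₁} B] {A : Type u₂} [Category.{v₂} A] {G : B ⥤ A}

/-- If `(T, κ)` is a right Kan extension of `G` along itself, this is the unique natural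
transformation `η : 𝟭 A ⟶ T` such that `η (G b) ≫ κ b = 𝟙 (G b)` for all `b`. -/
noncomputable def codensityUnit (T : A ⥤ A) (κ : G ⋙ T ⟶ G) [T.IsRightKanExtension κ] :
    𝟭 A ⟶ T :=
  T.liftOfIsRightKanExtension κ (𝟭 A) G.rightUnitor.hom

/-- If `(T, κ)` is a right Kan extension of `G` along itself, this is the unique natural
transformation `μ : T ⋙ T ⟶ T` such that `μ (G b) ≫ κ b = T (κ b) ≫ κ b` for all `b`. -/
noncomputable def codensityMul (T : A ⥤ A) (κ : G ⋙ T ⟶ G) [T.IsRightKanExtension κ] :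
    T ⋙ T ⟶ T :=
  T.liftOfIsRightKanExtension κ (T ⋙ T)
    ((Functor.associator G T T).inv ≫ Functor.whiskerRight κ T ≫ κ)

theorem codensityUnit_app (T : A ⥤ A) (κ : G ⋙ T ⟶ G) [T.IsRightKanExtension κ] (b : B) :
    (codensityUnit T κ).app (G.obj b) ≫ κ.app b = 𝟙 (G.obj b) := by
  have h := T.liftOfIsRightKanExtension_fac_app κ (𝟭 A) G.rightUnitor.hom b
  exact h

theorem codensityMul_app (T : A ⥤ A) (κ : G ⋙ T ⟶ G) [T.IsRightKanExtension κ] (b : B) :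
    (codensityMul T κ).app (G.obj b) ≫ κ.app b = T.map (κ.app b) ≫ κ.app b := by
  have h := T.liftOfIsRightKanExtension_fac_app κ (T ⋙ T)
    ((Functor.associator G T T).inv ≫ Functor.whiskerRight κ T ≫ κ) b
  exact h.trans (Category.id_comp _)

/-- The monad structure on a right Kan extension `(T, κ)` of `G` along itself: `(T, κ)` is the
terminal object of the monoidal category of pairs `(S, σ : G ⋙ S ⟶ G)`, and so carries a unique
monoid structure there. -/
noncomputable def codensityMonadOf (T : A ⥤ A) (κ : G ⋙ T ⟶ G) [T.IsRightKanExtension κ] :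
    Monad A where
  toFunctor := T
  η := codensityUnit T κ
  μ := codensityMul T κ
  assoc X := by
    have h : Functor.whiskerRight (codensityMul T κ) T ≫ codensityMul T κ =
        (Functor.associator T T T).hom ≫ Functor.whiskerLeft T (codensityMul T κ) ≫
          codensityMul T κ := by
      apply T.hom_ext_of_isRightKanExtension κ
      ext b
      have e : (codensityMul T κ).app (T.obj (G.obj b)) ≫ T.map (κ.app b) =
          T.map (T.map (κ.app b)) ≫ (codensityMul T κ).app (G.obj b) :=
        ((codensityMul T κ).naturality (κ.app b)).symm
      simp only [Functor.whiskerLeft_app, NatTrans.comp_app, Functor.whiskerRight_app,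
        Functor.associator_hom_app, Category.assoc, Category.id_comp, codensityMul_app]
      rw [← Functor.map_comp_assoc, codensityMul_app, reassoc_of% e, codensityMul_app,
        Functor.map_comp_assoc]
    simpa using congrArg (fun t => t.app X) h
  left_unit X := by
    have h : Functor.whiskerLeft T (codensityUnit T κ) ≫ codensityMul T κ =
        T.rightUnitor.hom := by
      apply T.hom_ext_of_isRightKanExtension κ
      ext b
      have e : (codensityUnit T κ).app (T.obj (G.obj b)) ≫ T.map (κ.app b) =
          κ.app b ≫ (codensityUnit T κ).app (G.obj b) :=
        ((codensityUnit T κ).naturality (κ.app b)).symm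
      simp only [Functor.whiskerLeft_app, NatTrans.comp_app, Functor.rightUnitor_hom_app,
        Category.assoc, codensityMul_app]
      rw [reassoc_of% e, codensityUnit_app, Category.comp_id]
      exact (Category.id_comp _).symm
    simpa using congrArg (fun t => t.app X) h
  right_unit X := by
    have h : Functor.whiskerRight (codensityUnit T κ) T ≫ codensityMul T κ =
        T.leftUnitor.hom := by
      apply T.hom_ext_of_isRightKanExtension κ
      ext b
      simp only [Functor.whiskerLeft_app, NatTrans.comp_app, Functor.whiskerRight_app,
        Functor.leftUnitor_hom_app, Category.assoc, codensityMul_app]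
      rw [← Functor.map_comp_assoc, codensityUnit_app]
      exact congrArg (fun t => t ≫ κ.app b) (T.map_id (G.obj b))
    simpa using congrArg (fun t => t.app X) h

/-- `G` has a codensity monad if for every object `a` of `A` the limit of `G b` over all pairs
`(b, f : a ⟶ G b)`, i.e. the end over `b` of the powers `[A(a, G b), G b]`, exists. -/
abbrev HasCodensityMonad (G : B ⥤ A) : Prop :=
  G.HasPointwiseRightKanExtension G

/-- The codensity monad of `G`. Its underlying functor sends `a` to the limit of `G b` over all
pairs `(b, f : a ⟶ G b)`. -/
noncomputable def codensityMonad (G : B ⥤ A) [HasCodensityMonad G] : Monad A :=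
  codensityMonadOf (G.pointwiseRightKanExtension G) (G.pointwiseRightKanExtensionCounit G)

end Codensity

/-- The category `Fam(Set)`: objects are families of sets `S x` indexed by a set `X`; a morphism
from `(S x)` to `(R y)` is a map `f : X → Y` together with a map `R (f x) → S x` for every `x`,
i.e. a morphism `S x ⟶ R (f x)` in the opposite of the category of sets. -/
abbrev FamSet : Type (u + 1) := FormalCoproduct.{u} (Type u)ᵒᵖ

/-- The families with a finite indexing set. -/
def isFinFam : ObjectProperty FamSet.{u} := fun S => Finite S.I

/-- The full subcategory `FinFam(Set)` of `Fam(Set)`. -/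
abbrev FinFamSet : Type (u + 1) := isFinFam.{u}.FullSubcategory

/-- The inclusion of `FinFam(Set)` into `Fam(Set)`. -/
abbrev finFamInclusion : FinFamSet.{u} ⥤ FamSet.{u} := isFinFam.{u}.ι

/-- The spaces with a sheaf of sets whose underlying space is compact and Hausdorff. -/
def isCompactHausdorffSheaf :
    ObjectProperty (AlgebraicGeometry.SheafedSpace.{u + 1, u, u} (Type u)) :=
  fun X => CompactSpace X.carrier ∧ T2Space X.carrier

/-- The category `CHSheaf`: objects are compact Hausdorff spaces `X` with a sheaf of sets `S`;
a morphism `(X, S) ⟶ (Y, R)` is a continuous map `f : X ⟶ Y` with a map of sheaves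
`R ⟶ f_* S` on `Y`, equivalently (by adjunction) a map of sheaves `f^* R ⟶ S` on `X`. -/
abbrev CHSheaf : Type (u + 1) := isCompactHausdorffSheaf.{u}.FullSubcategory

/-! The codensity monad is the ultraproduct monad. It sends a family $(S_x)_{x\in X}$ to the family
of ultraproducts indexed by the ultrafilters $U$ on $X$, whose elements are germs along $U$ of
partial sections (partial, so that a few empty $S_x$ do no harm). Indeed, a compatible family of
maps from $Z$ to the finite families under $A$ assigns, at a point $z$, a truth value to each subset
of the index set of $A$, and so gives an ultrafilter. A partial section of $A$ is a map to the
finite family `truthFamily`, so it is sent to an element of the fibre of $Z$ at $z$, which depends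
only on the germ. Hence `isPointwiseRightKanExtensionUltraproduct`.

An algebra is an algebra for the ultrafilter monad on $X$, that is, a compact Hausdorff topology
(Manes), with a map from $S_x$ to the ultraproduct along $U$ whenever $U$ converges to $x$, subject
to a unit and an associativity law. Stalks of a sheaf carry such maps: a germ at $x$ comes from a
section near $x$, hence defined almost everywhere along $U$. The functor `stalksAlgebra` is fully
faithful because sections are determined by their germs, and a property holds near $x$ if and only
if it holds along every ultrafilter converging to $x$.

The main point is essential surjectivity. In an algebra, $e\in S_x$ yields one germ for each $U$
converging to $x$. Associativity and the compactness of the set of these $U$ merge the germs into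
one partial section (`exists_forall_represents`). Associativity again shows that this section
represents its own values near $x$ (`exists_local_section`). Sections with this property form a
sheaf whose stalks are the $S_x$. -/

open Opposite Filter

/-! ### Maps of families, with fibre components transported along equalities of indices. -/

section Families

/-- The member of a family at an index. -/
abbrev FamSet.Fib (A : FamSet.{u}) (i : A.I) : Type u := (A.obj i).unop

/-- The family of sets `S` indexed by `X`. -/
abbrev FamSet.of {X : Type u} (S : X → Type u) : FamSet.{u} := ⟨X, fun x => op (S x)⟩

/-- The fibre component of a map of families, for any index `j` that equals the image of `i`. -/
def FamSet.fib {A B : FamSet.{u}} (m : A ⟶ B) (i : A.I) (j : B.I) (h : m.f i = j)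
    (r : B.Fib j) : A.Fib i :=
  (m.φ i).unop (cast (congrArg B.Fib h.symm) r)

/-- Constructor for maps of families. -/
abbrev FamSet.homMk {A B : FamSet.{u}} (f : A.I → B.I) (φ : ∀ i, B.Fib (f i) → A.Fib i) : A ⟶ B :=
  ⟨f, fun i => (↾(φ i)).op⟩

namespace FamSet

variable {A B C : FamSet.{u}}

@[simp]
theorem fib_id (i : A.I) (h) (r : A.Fib i) : fib (𝟙 A) i i h r = r := rfl

theorem fib_comp (m : A ⟶ B) (n : B ⟶ C) (i : A.I) (j : B.I) (k : C.I) (hj : m.f i = j)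
    (hk : n.f j = k) (h : (m ≫ n).f i = k) (r : C.Fib k) :
    fib (m ≫ n) i k h r = fib m i j hj (fib n j k hk r) := by
  subst hj; subst hk; rfl

/-- The fibre maps are compared at a common index `j`, so no transport between fibres enters. -/
theorem hom_ext {m n : A ⟶ B} (hf : ∀ i, m.f i = n.f i)
    (h : ∀ i j (hm : m.f i = j) (hn : n.f i = j) (r : B.Fib j), fib m i j hm r = fib n i j hn r) :
    m = n := by
  obtain ⟨f, φ⟩ := m
  obtain ⟨g, ψ⟩ := n
  obtain rfl : f = g := funext hf
  congr
  funext i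
  apply Quiver.Hom.unop_inj
  ext r
  exact h i (f i) rfl rfl r

theorem f_congr {m n : A ⟶ B} (h : m = n) (i : A.I) : m.f i = n.f i := by rw [h]

theorem fib_congr {m n : A ⟶ B} (h : m = n) (i : A.I) (j : B.I) (hm : m.f i = j) (hn : n.f i = j)
    (r : B.Fib j) : fib m i j hm r = fib n i j hn r := by
  subst h; rfl

theorem isIso_of_bijective (m : A ⟶ B) (hf : Function.Bijective m.f)
    (h : ∀ i, Function.Bijective (fib m i (m.f i) rfl)) : IsIso m := by
  let e : A.I ≃ B.I := Equiv.ofBijective _ hf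
  have hi : ∀ i, IsIso (m.φ i) := fun i => by
    have : IsIso (m.φ i).unop := (isIso_iff_bijective _).2 (h i)
    exact (isIso_unop_iff _).1 this
  exact (FormalCoproduct.isoOfComponents e fun i => @asIso _ _ _ _ (m.φ i) (hi i)).isIso_hom

end FamSet

end Families

/-! ### Ultraproducts as germs of partial sections, and the counit on finite families. -/

section Germs

variable {X : Type u}

/-- The ultraproduct of the sets `S x` along `U`: germs along `U` of partial sections of `S`. -/
def Germs (U : Ultrafilter X) (S : X → Type u) : Type u :=
  Quotient (α := {g : ∀ x, Option (S x) // ∀ᶠ x in U, (g x).isSome})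
    { r := fun g h => ∀ᶠ x in U, g.1 x = h.1 x
      iseqv :=
        { refl := fun _ => Eventually.of_forall fun _ => rfl
          symm := fun h => h.mono fun _ => Eq.symm
          trans := fun h k => by filter_upwards [h, k] with x using Eq.trans } }

namespace Germs

variable {U : Ultrafilter X} {S : X → Type u}

/-- The germ of a partial section that is defined almost everywhere. -/
def mk (g : ∀ x, Option (S x)) (hg : ∀ᶠ x in U, (g x).isSome) : Germs U S :=
  Quotient.mk _ ⟨g, hg⟩

theorem exists_rep (c : Germs U S) : ∃ g hg, c = mk g hg := by
  induction c using Quotient.ind with | _ g => exact ⟨g.1, g.2, rfl⟩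

theorem mk_eq_mk {g h : ∀ x, Option (S x)} {hg : ∀ᶠ x in U, (g x).isSome}
    {hh : ∀ᶠ x in U, (h x).isSome} : mk g hg = mk h hh ↔ ∀ᶠ x in U, g x = h x :=
  Quotient.eq (r := _)

open Classical in
/-- The germ of a partial section, if it is defined almost everywhere. -/
noncomputable def ofPartial (U : Ultrafilter X) (g : ∀ x, Option (S x)) : Option (Germs U S) :=
  if hg : ∀ᶠ x in U, (g x).isSome then some (mk g hg) else none

theorem ofPartial_of {g : ∀ x, Option (S x)} (hg : ∀ᶠ x in U, (g x).isSome) :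
    ofPartial U g = some (mk g hg) := dif_pos hg

theorem ofPartial_of_not {g : ∀ x, Option (S x)} (hg : ¬ ∀ᶠ x in U, (g x).isSome) :
    ofPartial U g = none := dif_neg hg

theorem isSome_ofPartial {g : ∀ x, Option (S x)} :
    (ofPartial U g).isSome ↔ ∀ᶠ x in U, (g x).isSome := by
  by_cases hg : ∀ᶠ x in U, (g x).isSome
  · simp [ofPartial_of hg, hg]
  · simp [ofPartial_of_not hg, hg]

theorem ofPartial_congr {g h : ∀ x, Option (S x)} (hgh : ∀ᶠ x in U, g x = h x) :
    ofPartial U g = ofPartial U h := by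
  by_cases hg : ∀ᶠ x in U, (g x).isSome
  · have hh : ∀ᶠ x in U, (h x).isSome := by filter_upwards [hg, hgh] with x a b using b ▸ a
    rw [ofPartial_of hg, ofPartial_of hh, mk_eq_mk.2 hgh]
  · have hh : ¬ ∀ᶠ x in U, (h x).isSome := fun hh => hg <| by
      filter_upwards [hh, hgh] with x a b using b ▸ a
    rw [ofPartial_of_not hg, ofPartial_of_not hh]

/-- No assumption that `h` is defined almost everywhere is needed: either side forces it. -/
theorem some_eq_ofPartial {g h : ∀ x, Option (S x)} {hg : ∀ᶠ x in U, (g x).isSome} :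
    some (mk g hg) = ofPartial U h ↔ ∀ᶠ x in U, g x = h x := by
  rw [← ofPartial_of hg]
  refine ⟨fun e => ?_, ofPartial_congr⟩
  have hh : ∀ᶠ x in U, (h x).isSome := isSome_ofPartial.1 (e ▸ isSome_ofPartial.2 hg)
  rw [ofPartial_of hg, ofPartial_of hh, Option.some_inj] at e
  exact mk_eq_mk.1 e

end Germs

open FamSet

/-- Pullback of partial sections along a map of families. -/
def FamSet.pull {A B : FamSet.{u}} (m : A ⟶ B) (g : ∀ y, Option (B.Fib y)) (x : A.I) :
    Option (A.Fib x) :=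
  (g (m.f x)).map (fib m x _ rfl)

theorem FamSet.pull_id {A : FamSet.{u}} (g : ∀ y, Option (A.Fib y)) : pull (𝟙 A) g = g := by
  funext x
  change Option.map id (g x) = g x
  simp

theorem FamSet.pull_comp {A B C : FamSet.{u}} (m : A ⟶ B) (n : B ⟶ C)
    (g : ∀ y, Option (C.Fib y)) : pull (m ≫ n) g = pull m (pull n g) := by
  funext x
  simp only [pull, Option.map_map]
  rfl

theorem FamSet.pull_congr {A B : FamSet.{u}} (m : A ⟶ B) {U : Ultrafilter A.I}
    {g h : ∀ y, Option (B.Fib y)} (hgh : ∀ᶠ y in U.map m.f, g y = h y) :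
    ∀ᶠ x in U, pull m g x = pull m h x := by
  have hgh : ∀ᶠ x in U, g (m.f x) = h (m.f x) := hgh
  filter_upwards [hgh] with x hx
  rw [pull, pull, hx]

theorem FamSet.isSome_pull {A B : FamSet.{u}} (m : A ⟶ B) {U : Ultrafilter A.I}
    {g : ∀ y, Option (B.Fib y)} :
    (∀ᶠ x in U, (pull m g x).isSome) ↔ ∀ᶠ y in U.map m.f, (g y).isSome := by
  simp only [pull, Option.isSome_map]
  rfl

/-- Pullback of germs along a map of families. -/
def Germs.comap {A B : FamSet.{u}} (m : A ⟶ B) (U : Ultrafilter A.I) :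
    Germs (U.map m.f) B.Fib → Germs U A.Fib :=
  Quotient.map' (s₁ := _) (s₂ := _) (fun g => ⟨pull m g.1, (isSome_pull m).2 g.2⟩)
    (fun _ _ hgh => pull_congr m hgh)

/-- The ultraproduct functor on families of sets. -/
abbrev ultraproduct : FamSet.{u} ⥤ FamSet.{u} where
  obj A := FamSet.of (X := Ultrafilter A.I) fun U => Germs U A.Fib
  map {A B} m := homMk (Ultrafilter.map m.f) (Germs.comap m)
  map_id A := by
    refine FamSet.hom_ext (fun U => Ultrafilter.map_id U) ?_
    rintro U _ hm rfl c
    obtain ⟨g, hg, rfl⟩ := Germs.exists_rep (U := U) c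
    -- `U.map id` equals `U` only propositionally, so the target is generalized to a variable `V`
    -- and then substituted.
    have h : ∀ (V : Ultrafilter A.I) (h : U.map id = V) (hg : ∀ᶠ x in V, (g x).isSome)
        (hg' : ∀ᶠ x in U, (g x).isSome),
        fib (homMk (A := FamSet.of (X := Ultrafilter A.I) fun U => Germs U A.Fib)
          (B := FamSet.of (X := Ultrafilter A.I) fun U => Germs U A.Fib)
          (Ultrafilter.map (𝟙 A : A ⟶ A).f) (Germs.comap (𝟙 A))) U V h (Germs.mk g hg) =
          Germs.mk g hg' := by
      rintro _ rfl _ _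
      exact Germs.mk_eq_mk.2 (Eventually.of_forall fun x => congrFun (pull_id g) x)
    exact h U hm hg hg
  map_comp {A B C} m n := by
    refine FamSet.hom_ext (fun U => (Ultrafilter.map_map U m.f n.f).symm) ?_
    rintro U _ rfl hn c
    obtain ⟨g, hg, rfl⟩ := Germs.exists_rep c
    rw [fib_comp (hj := rfl) (hk := hn)]
    exact Germs.mk_eq_mk.2 (Eventually.of_forall fun x => congrFun (pull_comp m n g) x)

theorem fib_ultraproduct_map {A B : FamSet.{u}} (m : A ⟶ B) (U : Ultrafilter A.I)
    (V : Ultrafilter B.I) (h : (ultraproduct.{u}.map m).f U = V) (g : ∀ y, Option (B.Fib y))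
    (hg : ∀ᶠ y in V, (g y).isSome) :
    fib (ultraproduct.{u}.map m) U V h (Germs.mk g hg) =
      Germs.mk (pull m g) ((isSome_pull.{u} m).2 (by subst h; exact hg)) := by
  subst h; rfl

section Finite

variable {X : Type u} [Finite X]

/-- The point at which an ultrafilter on a finite set is concentrated. -/
noncomputable def Ultrafilter.point (U : Ultrafilter X) : X := U.eq_pure_of_finite.choose

theorem Ultrafilter.eq_pure_point (U : Ultrafilter X) : U = pure U.point :=
  U.eq_pure_of_finite.choose_spec

theorem Ultrafilter.point_eq_iff {U : Ultrafilter X} {x : X} : U.point = x ↔ {x} ∈ U := by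
  conv_rhs => rw [U.eq_pure_point]
  rw [Ultrafilter.mem_pure, Set.mem_singleton_iff]

theorem Ultrafilter.eventually_iff_point {U : Ultrafilter X} {p : X → Prop} :
    (∀ᶠ x in U, p x) ↔ p U.point := by
  conv_lhs => rw [U.eq_pure_point]
  exact Ultrafilter.mem_pure

end Finite

open Classical in
/-- The partial section that is defined at one point. -/
noncomputable def partialSingle {X : Type u} {S : X → Type u} (x : X) (s : S x) :
    ∀ y, Option (S y) :=
  Function.update (fun _ => none) x (some s)

@[simp]
theorem partialSingle_self {X : Type u} {S : X → Type u} (x : X) (s : S x) :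
    partialSingle x s x = some s := by
  classical exact Function.update_self ..

instance (B : FinFamSet.{u}) : Finite B.obj.I := B.property

/-- The canonical map from the ultraproduct of a finite family to that family. -/
noncomputable def ultraproductCounitApp (B : FinFamSet.{u}) : ultraproduct.{u}.obj B.obj ⟶ B.obj :=
  homMk (A := ultraproduct.{u}.obj B.obj) Ultrafilter.point fun U r =>
    Germs.mk (partialSingle U.point r) (Ultrafilter.eventually_iff_point.2 (by simp))

theorem fib_ultraproductCounitApp (B : FinFamSet.{u}) (U : Ultrafilter B.obj.I) (y : B.obj.I)
    (h : U.point = y) (r : B.obj.Fib y) :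
    fib (ultraproductCounitApp B) U y h r =
      Germs.mk (partialSingle y r) (by
        subst h; exact Ultrafilter.eventually_iff_point.2 (by simp)) := by
  subst h; rfl

theorem ultraproductCounitApp_naturality {B C : FinFamSet.{u}} (m : B.obj ⟶ C.obj) :
    ultraproduct.{u}.map m ≫ ultraproductCounitApp C = ultraproductCounitApp B ≫ m := by
  have e : ∀ U : Ultrafilter B.obj.I, (U.map m.f).point = m.f U.point := fun U => by
    rw [Ultrafilter.point_eq_iff, Ultrafilter.mem_map]
    exact Ultrafilter.eventually_iff_point (p := fun x => m.f x = m.f U.point).2 rfl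
  refine FamSet.hom_ext e fun U y h h' r => ?_
  refine (fib_comp _ _ U _ _ rfl h h r).trans (Eq.trans ?_ (fib_comp (ultraproductCounitApp B) m U
    (Ultrafilter.point (X := B.obj.I) U) _ rfl h' h' r).symm)
  have h'' : m.f (Ultrafilter.point (X := B.obj.I) U) = y := h'
  subst h''
  refine (congrArg _ (fib_ultraproductCounitApp C (U.map m.f) _ (e U) r)).trans
    ((fib_ultraproduct_map m U _ rfl _ _).trans (Eq.trans ?_
      (fib_ultraproductCounitApp B U (Ultrafilter.point (X := B.obj.I) U) rfl _).symm))
  refine Germs.mk_eq_mk.2 (Ultrafilter.eventually_iff_point.2 ?_)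
  rw [partialSingle_self, pull, partialSingle_self]
  rfl

/-- The canonical maps from the ultraproducts of finite families to those families. -/
noncomputable abbrev ultraproductCounit :
    finFamInclusion.{u} ⋙ ultraproduct.{u} ⟶ finFamInclusion.{u} where
  app := ultraproductCounitApp.{u}
  naturality _ _ m := ultraproductCounitApp_naturality m.hom

end Germs

open FamSet

/-! ### The ultraproduct functor as a pointwise right Kan extension. -/

section KanExtension

/-- A finite family of sets. -/
abbrev FinFamSet.of {Y : Type u} [h : Finite Y] (R : Y → Type u) : FinFamSet.{u} := ⟨FamSet.of R, h⟩

/-- The map to the empty family over a finite set that is given by a map of the indexing sets. -/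
abbrev indexHom (A : FamSet.{u}) {Y : Type u} [Finite Y] (g : A.I → Y) :
    A ⟶ (FinFamSet.of.{u} fun _ : Y => PEmpty).obj :=
  homMk g fun _ => PEmpty.elim

/-- The family over the set of truth values whose members are the propositions. -/
abbrev truthFamily : FinFamSet.{u} := .of fun p : ULift.{u} Prop => ULift.{u} (PLift p.down)

/-- The map of families given by a partial section. -/
abbrev partialHom (A : FamSet.{u}) (g : ∀ x, Option (A.Fib x)) : A ⟶ truthFamily.{u}.obj :=
  homMk (fun x => ULift.up (g x).isSome) fun x h => (g x).get h.down.down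

/-- `truthFamily` classifies partial sections: the index map gives the domain, and as fibre maps go
backwards, the one-point fibre over a true proposition picks out the value. -/
theorem some_fib_partialHom {A : FamSet.{u}} (g : ∀ x, Option (A.Fib x)) (x : A.I)
    (p : ULift.{u} Prop) (h : (partialHom A g).f x = p) (r : ULift.{u} (PLift p.down)) :
    some (fib (partialHom A g) x p h r) = g x := by
  subst h
  exact Option.some_get _

theorem comp_partialHom {A B : FamSet.{u}} (α : A ⟶ B) (g : ∀ x, Option (B.Fib x)) :
    α ≫ partialHom B g = partialHom A (pull α g) := by
  refine FamSet.hom_ext (fun i => ?_) fun i p h h' r => ?_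
  · change ULift.up _ = ULift.up _
    simp [pull]
  · apply Option.some_injective
    rw [some_fib_partialHom, fib_comp (hj := rfl) (hk := h), pull, ← some_fib_partialHom g _ p h r]
    rfl

/-- A compatible family of maps from `Z` to the finite families under `A`. -/
structure TestCone (A Z : FamSet.{u}) where
  /-- The map to a finite family under `A`. -/
  hom (B : FinFamSet.{u}) (α : A ⟶ B.obj) : Z ⟶ B.obj
  naturality (B C : FinFamSet.{u}) (α : A ⟶ B.obj) (m : B.obj ⟶ C.obj) :
    hom B α ≫ m = hom C (α ≫ m)

theorem pull_partialSingle {A B : FamSet.{u}} (m : A ⟶ B) {x : A.I} {y : B.I} (h : m.f x = y)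
    (r : B.Fib y) : pull m (partialSingle y r) x = some (fib m x y h r) := by
  subst h
  simp [pull]

/-- The set `α⁻¹(y)` belongs to `U`, because `α` pushes `U` to the principal ultrafilter at `y`. The
elements `α_x(r)` over this set therefore define a germ. These maps are the legs of the limit cone.
-/
theorem fib_map_counit {A : FamSet.{u}} {B : FinFamSet.{u}} (α : A ⟶ B.obj) (U : Ultrafilter A.I)
    (y : B.obj.I) (h : (U.map α.f).point = y) (r : B.obj.Fib y) :
    fib (ultraproduct.{u}.map α ≫ ultraproductCounitApp B) U y h r =
      Germs.mk (pull α (partialSingle y r)) ((isSome_pull.{u} α).2 (by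
        subst h; exact Ultrafilter.eventually_iff_point.2 (by simp))) := by
  refine (fib_comp (ultraproduct.{u}.map α) (ultraproductCounitApp B) U _ _ rfl h h r).trans ?_
  refine (congrArg _ (fib_ultraproductCounitApp B (U.map α.f) y h r)).trans ?_
  exact fib_ultraproduct_map α U _ rfl _ _

namespace TestCone

variable {A Z : FamSet.{u}} (ω : TestCone A Z)

/-- Empty fibres in the target make every map of index sets a map of families, so naturality applies
to it. -/
theorem hom_indexHom_f {B : FinFamSet.{u}} (α : A ⟶ B.obj) {Y : Type u} [Finite Y]
    (g : B.obj.I → Y) (z : Z.I) :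
    (ω.hom _ (indexHom A fun x => g (α.f x))).f z = g ((ω.hom B α).f z) := by
  have h : α ≫ indexHom B.obj g = indexHom A fun x => g (α.f x) :=
    FamSet.hom_ext (fun _ => rfl) fun _ _ _ _ r => r.elim
  rw [← h, ← ω.naturality]
  rfl

/-- The truth value that is assigned to a predicate at a point. -/
def Holds (z : Z.I) (P : A.I → Prop) : Prop :=
  ((ω.hom _ (indexHom A fun x => ULift.up.{u} (P x))).f z).down

theorem holds_iff {B : FinFamSet.{u}} (α : A ⟶ B.obj) (P : B.obj.I → Prop) (z : Z.I) :
    ω.Holds z (fun x => P (α.f x)) ↔ P ((ω.hom B α).f z) :=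
  iff_of_eq (congrArg ULift.down (ω.hom_indexHom_f α (fun y => ULift.up.{u} (P y)) z))

theorem holds_const (z : Z.I) (p : Prop) : ω.Holds z (fun _ => p) ↔ p :=
  ω.holds_iff (indexHom A fun _ => PUnit.unit.{u + 1}) (fun _ => p) z

/-- The predicates are tested jointly: `P`, `Q` and their conjunction all factor through one map to
the finite set of pairs of truth values. -/
theorem holds_and (z : Z.I) (P Q : A.I → Prop) :
    ω.Holds z (fun x => P x ∧ Q x) ↔ ω.Holds z P ∧ ω.Holds z Q := by
  let g : A.I → ULift.{u} (Prop × Prop) := fun x => ULift.up (P x, Q x)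
  exact (ω.holds_iff (indexHom A g) (fun p => p.down.1 ∧ p.down.2) z).trans
    (and_congr (ω.holds_iff (indexHom A g) (fun p => p.down.1) z)
      (ω.holds_iff (indexHom A g) (fun p => p.down.2) z)).symm

theorem holds_not (z : Z.I) (P : A.I → Prop) : ω.Holds z (fun x => ¬ P x) ↔ ¬ ω.Holds z P :=
  (ω.holds_iff (indexHom A fun x => ULift.up.{u} (P x)) (fun p => ¬ p.down) z)

/-- The ultrafilter that a compatible family of maps assigns to a point. -/
def ultrafilter (z : Z.I) : Ultrafilter A.I :=
  .ofComplNotMemIff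
    { sets := {P | ω.Holds z (· ∈ P)}
      univ_sets := (ω.holds_const z True).2 trivial
      sets_of_superset := fun {P Q} hP hPQ => by
        have h : (fun x => x ∈ P ∧ x ∈ Q) = (fun x => x ∈ P) :=
          funext fun x => propext (and_iff_left_of_imp (@hPQ x))
        have hP : ω.Holds z fun x => x ∈ P := hP
        rw [← h, holds_and] at hP
        exact hP.2
      inter_sets := fun {P Q} hP hQ => (ω.holds_and z _ _).2 ⟨hP, hQ⟩ }
    fun P => (ω.holds_not z (· ∈ Pᶜ)).symm.trans <| by
      simp only [Set.mem_compl_iff, not_not]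
      rfl

theorem point_ultrafilter {B : FinFamSet.{u}} (α : A ⟶ B.obj) (z : Z.I) :
    ((ω.ultrafilter z).map α.f).point = (ω.hom B α).f z := by
  rw [Ultrafilter.point_eq_iff]
  exact (ω.holds_iff α (· = (ω.hom B α).f z) z).2 rfl

theorem hom_partialHom_f {z : Z.I} {g : ∀ x, Option (A.Fib x)}
    (hg : ∀ᶠ x in ω.ultrafilter z, (g x).isSome) :
    (ω.hom _ (partialHom A g)).f z = ULift.up.{u} True :=
  congrArg ULift.up (eq_true ((ω.holds_iff (partialHom A g) (fun p => p.down) z).1 hg))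

/-- The value of a compatible family of maps on a partial section. -/
def value (z : Z.I) (g : ∀ x, Option (A.Fib x)) (hg : ∀ᶠ x in ω.ultrafilter z, (g x).isSome) :
    Z.Fib z :=
  fib (ω.hom _ (partialHom A g)) z ⟨True⟩ (ω.hom_partialHom_f hg) ⟨⟨trivial⟩⟩

/-- Both sections factor through one finite family `E`, indexed by the truth values of "`g` is
defined" and "`h` is defined", whose fibres carry the value of `h`. Naturality along two maps from
`E` to `truthFamily` gives both values from the same element. -/
theorem value_congr_of_le {z : Z.I} {g h : ∀ x, Option (A.Fib x)}
    (hgh : ∀ x, (g x).isSome → g x = h x)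
    (hg : ∀ᶠ x in ω.ultrafilter z, (g x).isSome) (hh : ∀ᶠ x in ω.ultrafilter z, (h x).isSome) :
    ω.value z g hg = ω.value z h hh := by
  let E : FinFamSet.{u} := .of fun p : ULift.{u} (Prop × Prop) => ULift.{u} (PLift p.down.2)
  let α : A ⟶ E.obj := homMk (fun x => ULift.up ((g x).isSome, (h x).isSome))
    fun x k => (h x).get k.down.down
  have hα : (ω.hom E α).f z = ULift.up (True, True) := by
    have h1 := (ω.holds_iff α (fun p => p.down.1) z).1 hg
    have h2 := (ω.holds_iff α (fun p => p.down.2) z).1 hh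
    exact congrArg ULift.up (Prod.ext (eq_true h1) (eq_true h2))
  let m₁ : E.obj ⟶ truthFamily.{u}.obj := homMk (fun p => ULift.up (p.down.1 ∧ p.down.2))
    fun p k => ⟨⟨k.down.down.2⟩⟩
  let m₂ : E.obj ⟶ truthFamily.{u}.obj := homMk (fun p => ULift.up p.down.2)
    fun p k => k
  have e₂ : α ≫ m₂ = partialHom A h := rfl
  have e₁ : α ≫ m₁ = partialHom A g := by
    refine FamSet.hom_ext (fun x => ?_) fun x p k k' r => ?_
    · refine congrArg ULift.up (propext ⟨fun k => k.1, fun k => ⟨k, ?_⟩⟩)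
      exact Eq.subst (motive := fun o => (Option.isSome o : Prop)) (hgh x k) k
    · subst k
      apply Option.some_injective
      rw [some_fib_partialHom, hgh x r.down.down.1]
      exact Option.some_get _
  have hm₁ : m₁.f ⟨(True, True)⟩ = ULift.up True := congrArg ULift.up (and_self True)
  have l₁ := fib_congr (e₁ ▸ ω.naturality E _ α m₁ : ω.hom E α ≫ m₁ = ω.hom _ (partialHom A g))
    z ⟨True⟩ ((congrArg m₁.f hα).trans hm₁) (ω.hom_partialHom_f hg) ⟨⟨trivial⟩⟩
  have l₂ := fib_congr (e₂ ▸ ω.naturality E _ α m₂ : ω.hom E α ≫ m₂ = ω.hom _ (partialHom A h))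
    z ⟨True⟩ (congrArg m₂.f hα) (ω.hom_partialHom_f hh) ⟨⟨trivial⟩⟩
  rw [value, value, ← l₁, ← l₂, fib_comp (hj := hα) (hk := hm₁), fib_comp (hj := hα) (hk := rfl)]
  rfl

theorem value_congr {z : Z.I} {g h : ∀ x, Option (A.Fib x)}
    (hgh : ∀ᶠ x in ω.ultrafilter z, g x = h x)
    (hg : ∀ᶠ x in ω.ultrafilter z, (g x).isSome) (hh : ∀ᶠ x in ω.ultrafilter z, (h x).isSome) :
    ω.value z g hg = ω.value z h hh := by
  classical
  -- The restriction of `g` and `h` to the set where they agree is a restriction of both.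
  let k : ∀ x, Option (A.Fib x) := fun x => if g x = h x then g x else none
  have hk : ∀ᶠ x in ω.ultrafilter z, (k x).isSome := by
    filter_upwards [hgh, hg] with x h1 h2
    simp only [k, if_pos h1, h2]
  rw [← ω.value_congr_of_le (g := k) (fun x hx => ?_) hk hg,
    ← ω.value_congr_of_le (g := k) (fun x hx => ?_) hk hh]
  · by_cases e : g x = h x
    · simp [k, e]
    · simp [k, e] at hx
  · by_cases e : g x = h x
    · simp [k, e]
    · simp [k, e] at hx

/-- The map to the ultraproduct that is given by a compatible family of maps. -/
def lift : Z ⟶ ultraproduct.{u}.obj A :=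
  homMk (B := ultraproduct.{u}.obj A) ω.ultrafilter fun z =>
    Quotient.lift (s := _) (fun g => ω.value z g.1 g.2) fun _ _ hgh => ω.value_congr hgh _ _

theorem fib_lift (z : Z.I) (U : Ultrafilter A.I) (h : ω.ultrafilter z = U)
    (g : ∀ x, Option (A.Fib x)) (hg : ∀ᶠ x in U, (g x).isSome) :
    fib ω.lift z U h (Germs.mk g hg) = ω.value z g (by subst h; exact hg) := by
  subst h; rfl

/-- On fibres, this is naturality along the map from `B` to `truthFamily` that classifies the
partial section defined only at `y`, with value `r`. -/
theorem fac (B : FinFamSet.{u}) (α : A ⟶ B.obj) :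
    ω.lift ≫ ultraproduct.{u}.map α ≫ ultraproductCounitApp B = ω.hom B α := by
  refine FamSet.hom_ext (ω.point_ultrafilter α) fun z y h h' r => ?_
  refine (fib_comp ω.lift _ z (ω.ultrafilter z) _ rfl h h r).trans ?_
  refine (congrArg _ (fib_map_counit α (ω.ultrafilter z) y h r)).trans ?_
  refine (ω.fib_lift z _ rfl _ _).trans ?_
  have hr : ∀ᶠ x in ω.ultrafilter z, (pull α (partialSingle y r) x).isSome :=
    (isSome_pull.{u} α).2 (Ultrafilter.eventually_iff_point.2 (by
      rw [ω.point_ultrafilter α z, h', partialSingle_self]; rfl))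
  have hy : (partialHom B.obj (partialSingle y r)).f y = ULift.up True :=
    congrArg ULift.up (by simp)
  refine (fib_congr ((ω.naturality B _ α (partialHom B.obj (partialSingle y r))).trans
    (congrArg (ω.hom _) (comp_partialHom α _))) z ⟨True⟩ ((congrArg _ h').trans hy)
    (ω.hom_partialHom_f hr) _).symm.trans ?_
  rw [fib_comp (hj := h') (hk := hy)]
  congr 1
  apply Option.some_injective
  rw [some_fib_partialHom, partialSingle_self]

/-- The legs are jointly monic: membership of a set in an ultrafilter is read off from the leg at
its indicator map, and every germ lies in the image of the leg at a map to `truthFamily`. -/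
theorem hom_ext_ultraproduct {m n : Z ⟶ ultraproduct.{u}.obj A}
    (h : ∀ (B : FinFamSet.{u}) (α : A ⟶ B.obj),
      m ≫ ultraproduct.{u}.map α ≫ ultraproductCounitApp B =
        n ≫ ultraproduct.{u}.map α ≫ ultraproductCounitApp B) : m = n := by
  have key (m : Z ⟶ ultraproduct.{u}.obj A) (z : Z.I) (P : Set A.I) :
      P ∈ (show Ultrafilter A.I from m.f z) ↔
      ((m ≫ ultraproduct.{u}.map (indexHom A fun x => ULift.up.{u} (x ∈ P)) ≫
        ultraproductCounitApp _).f z).down := by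
    refine Iff.trans ?_ (Ultrafilter.eventually_iff_point (p := fun q : ULift.{u} Prop => q.down)
      (U := Ultrafilter.map (fun x => ULift.up.{u} (x ∈ P)) (m.f z)))
    rfl
  refine FamSet.hom_ext (fun z => ?_) ?_
  · refine Ultrafilter.ext fun P => ?_
    rw [key m, key n, h]
  · rintro z U hm hn c
    obtain ⟨g, hg, rfl⟩ := Germs.exists_rep (U := U) c
    have hU : (Ultrafilter.map (partialHom A g).f U).point = ULift.up True :=
      congrArg ULift.up (eq_true ((Ultrafilter.eventually_iff_point
        (p := fun q : ULift.{u} Prop => q.down) (U := U.map (partialHom A g).f)).1 hg))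
    have e := fib_map_counit (partialHom A g) U ⟨True⟩ hU ⟨⟨trivial⟩⟩
    have e' : Germs.mk g hg = fib (ultraproduct.{u}.map (partialHom A g) ≫
        ultraproductCounitApp truthFamily) U ⟨True⟩ hU ⟨⟨trivial⟩⟩ := by
      rw [e]
      refine Germs.mk_eq_mk.2 ?_
      filter_upwards [hg] with x hx
      rw [pull_partialSingle (partialHom A g) (congrArg ULift.up (eq_true hx)),
        some_fib_partialHom]
    have hm' : (m ≫ ultraproduct.{u}.map (partialHom A g) ≫
        ultraproductCounitApp truthFamily).f z = ULift.up True := by subst hm; exact hU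
    have hn' : (n ≫ ultraproduct.{u}.map (partialHom A g) ≫
        ultraproductCounitApp truthFamily).f z = ULift.up True := by subst hn; exact hU
    rw [e']
    exact (fib_comp m _ z U _ hm hU hm' _).symm.trans
      ((fib_congr (h _ _) _ _ _ hn' _).trans (fib_comp n _ z U _ hn hU hn' _))

end TestCone

/-- The compatible family of maps given by a cone over the finite families under `A`. -/
def TestCone.ofCone {A : FamSet.{u}}
    (s : Cone (StructuredArrow.proj A finFamInclusion.{u} ⋙ finFamInclusion.{u})) :
    TestCone A s.pt where
  hom B α := s.π.app (StructuredArrow.mk (Y := B) α)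
  naturality B C α m :=
    s.w (StructuredArrow.homMk (f := StructuredArrow.mk (S := A) (T := finFamInclusion.{u}) (Y := B) α)
      (f' := StructuredArrow.mk (S := A) (T := finFamInclusion.{u}) (Y := C) (α ≫ m))
      (ObjectProperty.homMk m) rfl)

/-- The ultraproduct functor is a pointwise right Kan extension of the inclusion of the finite
families along itself. -/
def isPointwiseRightKanExtensionUltraproduct :
    (Functor.RightExtension.mk ultraproduct.{u}
      ultraproductCounit.{u}).IsPointwiseRightKanExtension := fun _ =>
  { lift := fun s => (TestCone.ofCone s).lift
    fac := fun s j => (TestCone.ofCone s).fac j.right j.hom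
    uniq := fun s _ hm => TestCone.hom_ext_ultraproduct fun B α =>
      (hm (StructuredArrow.mk (Y := B) α)).trans ((TestCone.ofCone s).fac B α).symm }

instance : HasCodensityMonad finFamInclusion.{u} :=
  isPointwiseRightKanExtensionUltraproduct.{u}.hasPointwiseRightKanExtension

instance : ultraproduct.{u}.IsRightKanExtension ultraproductCounit.{u} :=
  isPointwiseRightKanExtensionUltraproduct.{u}.isRightKanExtension

end KanExtension

/-! ### Independence of the codensity monad from the chosen Kan extension. -/

section Uniqueness

universe v₁ v₂ u₁ u₂

variable {B : Type u₁} [Category.{v₁} B] {A : Type u₂} [Category.{v₂} A] {G : B ⥤ A}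

/-- Any two right Kan extensions of a functor along itself are isomorphic as monads. -/
noncomputable def codensityMonadOfIso (T T' : A ⥤ A) (κ : G ⋙ T ⟶ G) (κ' : G ⋙ T' ⟶ G)
    [T.IsRightKanExtension κ] [T'.IsRightKanExtension κ'] :
    codensityMonadOf T κ ≅ codensityMonadOf T' κ' :=
  let e := T.rightKanExtensionUnique κ T' κ'
  have he (b : B) : e.hom.app (G.obj b) ≫ κ'.app b = κ.app b :=
    (T'.liftOfIsRightKanExtension_fac_app κ' T (κ ≫ 𝟙 G) b).trans (by simp)
  MonadIso.mk e
    (fun X => by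
      have h : codensityUnit T κ ≫ e.hom = codensityUnit T' κ' := by
        apply T'.hom_ext_of_isRightKanExtension κ'
        ext b
        simp only [NatTrans.comp_app, Functor.whiskerLeft_app, Category.assoc, he,
          codensityUnit_app]
      exact congrArg (fun t => t.app X) h)
    (fun X => by
      have h : codensityMul T κ ≫ e.hom =
          (Functor.whiskerRight e.hom T ≫ Functor.whiskerLeft T' e.hom) ≫ codensityMul T' κ' := by
        apply T'.hom_ext_of_isRightKanExtension κ'
        ext b
        simp only [NatTrans.comp_app, Functor.whiskerLeft_app, Functor.whiskerRight_app,
          Category.assoc, he, codensityMul_app]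
        rw [← NatTrans.naturality_assoc, he, ← Functor.map_comp_assoc, he]
      exact congrArg (fun t => t.app X) h)

end Uniqueness

/-! ### Unit, multiplication and algebra laws of the ultraproduct monad in terms of germs. -/

section Monad

/-- The codensity monad of the inclusion of the finite families, on the ultraproduct functor. -/
noncomputable abbrev ultraproductMonad : Monad FamSet.{u} :=
  codensityMonadOf ultraproduct.{u} ultraproductCounit.{u}

/-- The unit of the ultraproduct monad at a family. -/
def ultraproductUnitApp (A : FamSet.{u}) : A ⟶ ultraproduct.{u}.obj A :=
  homMk (B := ultraproduct.{u}.obj A) (fun x => (pure x : Ultrafilter A.I)) fun x =>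
    Quotient.lift (s := _) (fun g => (g.1 x).get g.2) fun g h (hgh : g.1 x = h.1 x) => by
      simp only [hgh]

theorem some_fib_ultraproductUnitApp (A : FamSet.{u}) (x : A.I) (U : Ultrafilter A.I)
    (h : pure x = U) (g : ∀ x, Option (A.Fib x)) (hg : ∀ᶠ x in U, (g x).isSome) :
    some (fib (ultraproductUnitApp A) x U h (Germs.mk g hg)) = g x := by
  subst h
  exact Option.some_get _

/-- It suffices to compose with the limit legs. By naturality and the defining equation of the unit,
the leg at `α` turns the left side into `α`. -/
theorem codensityUnit_ultraproduct_app (A : FamSet.{u}) :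
    (codensityUnit ultraproduct.{u} ultraproductCounit.{u}).app A = ultraproductUnitApp A := by
  refine TestCone.hom_ext_ultraproduct fun B α => ?_
  trans α
  · exact ((codensityUnit ultraproduct.{u} ultraproductCounit.{u}).naturality_assoc α _).symm.trans
      ((congrArg (α ≫ ·) (codensityUnit_app ultraproduct.{u} ultraproductCounit.{u} B)).trans
        (Category.comp_id α))
  · have hp (x : A.I) : (Ultrafilter.map α.f (pure x)).point = α.f x :=
      Ultrafilter.point_eq_iff.2 rfl
    refine FamSet.hom_ext (fun x => (hp x).symm) fun x y h h' r => ?_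
    apply Option.some_injective
    rw [fib_comp (ultraproductUnitApp A) (ultraproduct.{u}.map α ≫ ultraproductCounitApp B) x
      (pure x) y rfl h' h']
    rw [← pull_partialSingle α h r]
    refine (some_fib_ultraproductUnitApp A x _ rfl _ ?_).symm.trans ?_
    · change Option.isSome _
      rw [pull_partialSingle α h]
      rfl
    · exact congrArg (fun c => some (fib (ultraproductUnitApp A) x (pure x) rfl c))
        (fib_map_counit α (pure x) y h' r).symm

/-- The multiplication of the ultrafilter monad. -/
def Ultrafilter.join {X : Type u} (W : Ultrafilter (Ultrafilter X)) : Ultrafilter X := W.bind id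

theorem Ultrafilter.eventually_join {X : Type u} {W : Ultrafilter (Ultrafilter X)} {p : X → Prop} :
    (∀ᶠ x in Ultrafilter.join W, p x) ↔
      ∀ᶠ U : Ultrafilter X in (W : Filter (Ultrafilter X)), ∀ᶠ x in U, p x := Iff.rfl

/-- The multiplication of the ultraproduct monad at a family. -/
noncomputable def ultraproductMulApp (A : FamSet.{u}) :
    ultraproduct.{u}.obj (ultraproduct.{u}.obj A) ⟶ ultraproduct.{u}.obj A :=
  homMk (A := ultraproduct.{u}.obj (ultraproduct.{u}.obj A)) (B := ultraproduct.{u}.obj A)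
    Ultrafilter.join fun (W : Ultrafilter (Ultrafilter A.I)) =>
      Quotient.lift (s := _) (fun g => Germs.mk (U := W) (fun U => Germs.ofPartial U g.1) (by
        have hg : ∀ᶠ x in Ultrafilter.join W, (g.1 x).isSome := g.2
        filter_upwards [Ultrafilter.eventually_join.1 hg] with U using Germs.isSome_ofPartial.2)) fun g h hgh => Germs.mk_eq_mk.2 <| by
          have hgh : ∀ᶠ U : Ultrafilter A.I in (W : Filter (Ultrafilter A.I)), ∀ᶠ x in U,
              g.1 x = h.1 x := hgh
          filter_upwards [hgh] with U using Germs.ofPartial_congr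

theorem fib_ultraproductMulApp (A : FamSet.{u}) (W : Ultrafilter (Ultrafilter A.I))
    (U : Ultrafilter A.I) (h : Ultrafilter.join W = U) (g : ∀ x, Option (A.Fib x))
    (hg : ∀ᶠ x in U, (g x).isSome) :
    fib (ultraproductMulApp A) W U h (Germs.mk g hg) =
      Germs.mk (U := W) (S := fun U => Germs U A.Fib) (fun U => Germs.ofPartial U g) (by
        subst h
        filter_upwards [Ultrafilter.eventually_join.1 hg] with U using Germs.isSome_ofPartial.2) := by
  subst h; rfl

theorem codensityMul_ultraproduct_app (A : FamSet.{u}) :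
    (codensityMul ultraproduct.{u} ultraproductCounit.{u}).app A = ultraproductMulApp A := by
  refine TestCone.hom_ext_ultraproduct fun B α => ?_
  let m : ultraproduct.{u}.obj A ⟶ B.obj := ultraproduct.{u}.map α ≫ ultraproductCounitApp B
  trans ultraproduct.{u}.map m ≫ ultraproductCounitApp B
  · refine ((codensityMul ultraproduct.{u} ultraproductCounit.{u}).naturality_assoc α _).symm.trans
      ((congrArg (_ ≫ ·) (codensityMul_app ultraproduct.{u} ultraproductCounit.{u} B)).trans ?_)
    rw [← Category.assoc]
    exact congrArg (· ≫ ultraproductCounitApp B) (ultraproduct.{u}.map_comp _ _).symm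
  -- Almost all `U` along `W` lie over the point where the image of `W` is concentrated, so the join
  -- of `W` lies over it too.
  · have hp (W : Ultrafilter (Ultrafilter A.I)) :
        (Ultrafilter.map α.f (Ultrafilter.join W)).point = (Ultrafilter.map m.f W).point := by
      rw [Ultrafilter.point_eq_iff]
      have h : ∀ᶠ U : Ultrafilter A.I in (W : Filter (Ultrafilter A.I)),
          m.f U = (Ultrafilter.map m.f W).point :=
        (Ultrafilter.point_eq_iff (U := Ultrafilter.map m.f W)).1 rfl
      refine Ultrafilter.eventually_join.2 ?_
      filter_upwards [h] with U hU
      rw [← hU]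
      exact (Ultrafilter.point_eq_iff (U := U.map α.f)).1 rfl
    refine FamSet.hom_ext (fun W => (hp W).symm) fun W y h h' r => ?_
    refine (fib_map_counit (A := ultraproduct.{u}.obj A) m W y h r).trans (Eq.symm ?_)
    refine (fib_comp (ultraproductMulApp A) m W (Ultrafilter.join W) y rfl h' h' r).trans ?_
    refine (congrArg (fib (ultraproductMulApp A) W (Ultrafilter.join W) rfl)
      (fib_map_counit α (Ultrafilter.join W) y h' r)).trans ?_
    refine (fib_ultraproductMulApp A W _ rfl _ _).trans (Germs.mk_eq_mk.2 ?_)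
    have hy : ∀ᶠ U : Ultrafilter A.I in ((show Ultrafilter (Ultrafilter A.I) from W) :
        Filter (Ultrafilter A.I)), m.f U = y :=
      (Ultrafilter.point_eq_iff (U := Ultrafilter.map m.f W)).1 h
    filter_upwards [hy] with U hU
    rw [pull_partialSingle m hU, Germs.ofPartial_of]
    · exact congrArg some (fib_map_counit α U y hU r).symm
    · have hU : (U.map α.f).point = y := hU
      exact (isSome_pull.{u} α).2 (Ultrafilter.eventually_iff_point.2 (by
        rw [hU, partialSingle_self]; rfl))

/-- For `a : T A ⟶ A`, the partial section `g` represents the image of `e`, which lies over `x`,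
in the ultraproduct along `U`. -/
def Represents {A : FamSet.{u}} (a : ultraproduct.{u}.obj A ⟶ A) (U : Ultrafilter A.I) (x : A.I)
    (e : A.Fib x) (g : ∀ y, Option (A.Fib y)) : Prop :=
  ∃ h : a.f U = x, some (fib a U x h e) = Germs.ofPartial U g

namespace Represents

variable {A B : FamSet.{u}} {a : ultraproduct.{u}.obj A ⟶ A} {b : ultraproduct.{u}.obj B ⟶ B}
  {U : Ultrafilter A.I} {x : A.I} {e : A.Fib x} {g g' : ∀ y, Option (A.Fib y)}

theorem exists_of_eq (h : a.f U = x) (e : A.Fib x) : ∃ g, Represents a U x e g := by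
  obtain ⟨g, hg, hc⟩ := Germs.exists_rep (U := U) (fib a U x h e)
  exact ⟨g, h, by rw [Germs.ofPartial_of hg]; exact congrArg some hc⟩

theorem isSome (h : Represents a U x e g) : ∀ᶠ y in U, (g y).isSome := by
  obtain ⟨_, h⟩ := h
  exact Germs.isSome_ofPartial.1 (h ▸ rfl)

theorem congr (h : Represents a U x e g) (hg : ∀ᶠ y in U, g y = g' y) : Represents a U x e g' :=
  ⟨h.1, h.2.trans (Germs.ofPartial_congr hg)⟩

theorem unique (h : Represents a U x e g) (h' : Represents a U x e g') : ∀ᶠ y in U, g y = g' y := by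
  have e := h.2.symm.trans h'.2
  rw [Germs.ofPartial_of h.isSome] at e
  exact Germs.some_eq_ofPartial.1 e

theorem fib_eq (h : Represents a U x e g) (hx : a.f U = x) : fib a U x hx e = Germs.mk g h.isSome :=
  Option.some_injective _ (h.2.trans (Germs.ofPartial_of h.isSome))

theorem of_fib_eq {hx : a.f U = x} {hg : ∀ᶠ y in U, (g y).isSome}
    (h : fib a U x hx e = Germs.mk g hg) : Represents a U x e g :=
  ⟨hx, by rw [h, Germs.ofPartial_of hg]⟩

end Represents

theorem ultraproductUnitApp_comp_eq_id {A : FamSet.{u}} (a : ultraproduct.{u}.obj A ⟶ A) :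
    ultraproductUnitApp A ≫ a = 𝟙 A ↔ (∀ x, a.f (pure x : Ultrafilter A.I) = x) ∧
      ∀ x e g, Represents a (pure x) x e g → g x = some e := by
  constructor
  · intro h
    refine ⟨fun x => f_congr h x, fun x e g hg => ?_⟩
    have k := fib_congr h x x (f_congr h x) rfl e
    rw [fib_id] at k
    rw [← k, ← some_fib_ultraproductUnitApp A x _ rfl g hg.isSome, ← hg.fib_eq (f_congr h x)]
    exact congrArg some (fib_comp (ultraproductUnitApp A) a x _ x rfl _ _ e).symm
  · rintro ⟨h₁, h₂⟩
    refine FamSet.hom_ext h₁ fun x y h h' e => ?_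
    obtain rfl : x = y := h'
    obtain ⟨g, hg⟩ := Represents.exists_of_eq (h₁ x) e
    apply Option.some_injective
    rw [fib_id, ← h₂ x e g hg, ← some_fib_ultraproductUnitApp A x _ rfl g hg.isSome,
      ← hg.fib_eq (h₁ x)]
    exact congrArg some (fib_comp (ultraproductUnitApp A) a x _ x rfl (h₁ x) _ e)

/-- One composite sends `e` to the germ along `W` of the map from `U` to the germ of `g` along `U`;
the other applies the action at `U` to `g' (a.f U)`. Equality of germs along `W` means that these
agree for almost all `U`. -/
theorem ultraproductMulApp_comp_eq {A : FamSet.{u}} (a : ultraproduct.{u}.obj A ⟶ A) :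
    ultraproductMulApp A ≫ a = ultraproduct.{u}.map a ≫ a ↔
      (∀ W : Ultrafilter (Ultrafilter A.I), a.f (Ultrafilter.join W) = a.f (W.map a.f)) ∧
      ∀ (W : Ultrafilter (Ultrafilter A.I)) x e g g', Represents a (Ultrafilter.join W) x e g →
        Represents a (W.map a.f) x e g' →
        ∀ᶠ U : Ultrafilter A.I in (W : Filter (Ultrafilter A.I)), ∀ e', g' (a.f U) = some e' →
          Represents a U (a.f U) e' g := by
  have key (W : Ultrafilter (Ultrafilter A.I)) (x e g g')
      (hg : Represents a (Ultrafilter.join W) x e g) (hg' : Represents a (W.map a.f) x e g')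
      (h : (ultraproductMulApp A ≫ a).f W = x) (h' : (ultraproduct.{u}.map a ≫ a).f W = x) :
      fib (ultraproductMulApp A ≫ a) W x h e = fib (ultraproduct.{u}.map a ≫ a) W x h' e ↔
        ∀ᶠ U : Ultrafilter A.I in (W : Filter (Ultrafilter A.I)), ∀ e', g' (a.f U) = some e' →
          Represents a U (a.f U) e' g := by
    have k₁ : fib (ultraproductMulApp A ≫ a) W x h e =
        Germs.mk (U := W) (S := fun U => Germs U A.Fib) (fun U => Germs.ofPartial U g) _ :=
      (fib_comp (ultraproductMulApp A) a W _ x rfl h h e).trans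
        ((congrArg _ (hg.fib_eq h)).trans (fib_ultraproductMulApp A W _ rfl g hg.isSome))
    have k₂ : fib (ultraproduct.{u}.map a ≫ a) W x h' e = Germs.mk (U := W) (pull a g') _ :=
      (fib_comp (ultraproduct.{u}.map a) a W _ x rfl h' h' e).trans
        ((congrArg _ (hg'.fib_eq h')).trans (fib_ultraproduct_map a W _ rfl g' hg'.isSome))
    rw [k₁, k₂]
    refine Germs.mk_eq_mk.trans ⟨fun k => ?_, fun k => ?_⟩
    · filter_upwards [k] with U hU e' he'
      exact ⟨rfl, by rw [hU, pull, he']; rfl⟩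
    -- The condition is vacuous where `g'` is undefined, but `g'` is defined at `a.f U` for almost
    -- all `U`.
    · have hs : ∀ᶠ U : Ultrafilter A.I in (W : Filter (Ultrafilter A.I)), (g' (a.f U)).isSome :=
        hg'.isSome
      filter_upwards [k, hs] with U hU hs
      obtain ⟨e', he'⟩ := Option.isSome_iff_exists.1 hs
      obtain ⟨_, he⟩ := hU e' he'
      rw [← he, pull, he']
      rfl
  constructor
  · intro h
    exact ⟨fun W => f_congr h W, fun W x e g g' hg hg' =>
      (key W x e g g' hg hg' hg.1 hg'.1).1 (fib_congr h W x _ _ e)⟩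
  · rintro ⟨h₁, h₂⟩
    refine FamSet.hom_ext h₁ fun W x h h' e => ?_
    obtain ⟨g, hg⟩ := Represents.exists_of_eq (U := Ultrafilter.join W) h e
    obtain ⟨g', hg'⟩ := Represents.exists_of_eq (U := Ultrafilter.map a.f W) h' e
    exact (key W x e g g' hg hg' h h').2 (h₂ W x e g g' hg hg')

theorem ultraproduct_map_comp_eq {A B : FamSet.{u}} (a : ultraproduct.{u}.obj A ⟶ A)
    (b : ultraproduct.{u}.obj B ⟶ B) (m : A ⟶ B) :
    ultraproduct.{u}.map m ≫ b = a ≫ m ↔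
      (∀ U : Ultrafilter A.I, b.f (U.map m.f) = m.f (a.f U)) ∧
      ∀ (U : Ultrafilter A.I) x y (h : m.f x = y) e g, a.f U = x → Represents b (U.map m.f) y e g →
        Represents a U x (fib m x y h e) (pull m g) := by
  have key (U : Ultrafilter A.I) (x y) (h : m.f x = y) (e g) (hx : a.f U = x)
      (hg : Represents b (U.map m.f) y e g) (k : (ultraproduct.{u}.map m ≫ b).f U = y)
      (k' : (a ≫ m).f U = y) :
      fib (ultraproduct.{u}.map m ≫ b) U y k e = fib (a ≫ m) U y k' e ↔
        Represents a U x (fib m x y h e) (pull m g) := by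
    have k₁ : fib (ultraproduct.{u}.map m ≫ b) U y k e = Germs.mk (pull m g) _ :=
      (fib_comp (ultraproduct.{u}.map m) b U _ y rfl k k e).trans
        ((congrArg _ (hg.fib_eq k)).trans (fib_ultraproduct_map m U _ rfl g hg.isSome))
    rw [k₁, fib_comp a m U x y hx h]
    exact ⟨fun h => .of_fib_eq h.symm, fun h => (h.fib_eq hx).symm⟩
  constructor
  · intro h
    exact ⟨fun U => f_congr h U, fun U x y hxy e g hx hg =>
      (key U x y hxy e g hx hg hg.1 (by subst hx; exact hxy)).1 (fib_congr h U y _ _ e)⟩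
  · rintro ⟨h₁, h₂⟩
    refine FamSet.hom_ext h₁ fun U y h h' e => ?_
    obtain ⟨g, hg⟩ := Represents.exists_of_eq (U := Ultrafilter.map m.f U) h e
    exact (key U (a.f U) y h' e g rfl hg h h').2 (h₂ U _ y h' e g rfl hg)

end Monad

open TopologicalSpace AlgebraicGeometry
open scoped Topology

/-! ### The algebra of stalks of a sheaf on a compact Hausdorff space. -/

section SheafedSpace

/-- The sheafed spaces of sets. -/
abbrev SetSpace : Type (u + 1) := SheafedSpace.{u + 1, u, u} (Type u)

namespace SetSpace

variable (X Y : SetSpace.{u})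

/-- The family of the stalks of a sheafed space. -/
abbrev stalks : FamSet.{u} := FamSet.of fun x : X.carrier => X.presheaf.stalk x

variable {X Y}

open Classical in
/-- The germs of a section over an open set, as a partial section of the family of stalks. -/
noncomputable def germs (W : Opens X.carrier) (s : X.presheaf.obj (op W)) (y : X.carrier) :
    Option (X.presheaf.stalk y) :=
  if h : y ∈ W then some (X.presheaf.germ W y h s) else none

theorem germs_of_mem {W : Opens X.carrier} (s : X.presheaf.obj (op W)) {y : X.carrier}
    (h : y ∈ W) : germs W s y = some (X.presheaf.germ W y h s) := dif_pos h

theorem germs_of_notMem {W : Opens X.carrier} (s : X.presheaf.obj (op W)) {y : X.carrier}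
    (h : y ∉ W) : germs W s y = none := dif_neg h

theorem germs_eq_some {W : Opens X.carrier} {s : X.presheaf.obj (op W)} {y : X.carrier}
    {e : X.presheaf.stalk y} (h : germs W s y = some e) : ∃ hy : y ∈ W, X.presheaf.germ W y hy s = e := by
  by_cases hy : y ∈ W
  · rw [germs_of_mem s hy] at h
    exact ⟨hy, Option.some_injective _ h⟩
  · rw [germs_of_notMem s hy] at h
    cases h

theorem isSome_germs {W : Opens X.carrier} (s : X.presheaf.obj (op W)) {x : X.carrier} (hx : x ∈ W)
    {U : Ultrafilter X.carrier} (hU : (U : Filter X.carrier) ≤ 𝓝 x) :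
    ∀ᶠ y in U, (germs W s y).isSome := by
  filter_upwards [hU (W.isOpen.mem_nhds hx)] with y hy
  rw [germs_of_mem s hy]
  rfl

theorem eventually_germs_eq {W W' : Opens X.carrier} {s : X.presheaf.obj (op W)}
    {s' : X.presheaf.obj (op W')} {x : X.carrier} (hx : x ∈ W) (hx' : x ∈ W')
    (h : X.presheaf.germ W x hx s = X.presheaf.germ W' x hx' s') :
    ∀ᶠ y in 𝓝 x, germs W s y = germs W' s' y := by
  obtain ⟨V, hV, i, i', e⟩ := X.presheaf.germ_eq x hx hx' s s' h
  filter_upwards [V.isOpen.mem_nhds hV] with y hy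
  rw [germs_of_mem s (i.le hy), germs_of_mem s' (i'.le hy), ← X.presheaf.germ_res_apply i y hy,
    e, X.presheaf.germ_res_apply]

variable (X) in
theorem exists_germ {x : X.carrier} (e : X.presheaf.stalk x) :
    ∃ (W : Opens X.carrier) (hx : x ∈ W) (s : X.presheaf.obj (op W)),
      X.presheaf.germ W x hx s = e :=
  X.presheaf.exists_germ_eq e

/-- The map on stalks induced by a map of sheafed spaces. -/
noncomputable def stalksMap (m : X ⟶ Y) : stalks X ⟶ stalks Y :=
  homMk (A := stalks X) (B := stalks Y) m.hom.base fun x => m.hom.stalkMap x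

theorem fib_stalksMap_germ (m : X ⟶ Y) (x : X.carrier) (y : Y.carrier) (h : m.hom.base x = y)
    (W : Opens Y.carrier) (hy : y ∈ W) (s : Y.presheaf.obj (op W)) :
    fib (stalksMap m) x y h (Y.presheaf.germ W y hy s) =
      X.presheaf.germ ((Opens.map m.hom.base).obj W) x (by subst h; exact hy)
        (m.hom.c.app (op W) s) := by
  subst h
  exact PresheafedSpace.stalkMap_germ_apply m.hom W x hy s

theorem pull_stalksMap_germs (m : X ⟶ Y) (W : Opens Y.carrier) (s : Y.presheaf.obj (op W)) :
    pull (stalksMap m) (germs W s) = germs ((Opens.map m.hom.base).obj W) (m.hom.c.app (op W) s) := by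
  funext x
  by_cases hx : m.hom.base x ∈ W
  · have h : germs W s ((stalksMap m).f x) = _ := germs_of_mem s hx
    rw [pull, h, germs_of_mem (W := (Opens.map m.hom.base).obj W) _ hx]
    exact congrArg some (fib_stalksMap_germ m x _ rfl W hx s)
  · have h : germs W s ((stalksMap m).f x) = _ := germs_of_notMem s hx
    rw [pull, h, germs_of_notMem (W := (Opens.map m.hom.base).obj W) _ hx]
    rfl

section Action

variable [CompactSpace X.carrier] [T2Space X.carrier] [CompactSpace Y.carrier] [T2Space Y.carrier]

variable (X) in
/-- The action of the ultraproduct monad on the stalks of a sheaf on a compact Hausdorff space. -/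
noncomputable def action : ultraproduct.{u}.obj (stalks X) ⟶ stalks X :=
  homMk (A := ultraproduct.{u}.obj (stalks X)) (B := stalks X)
    (Ultrafilter.lim (X := X.carrier)) fun U e =>
      Germs.mk (germs (exists_germ X e).choose (exists_germ X e).choose_spec.choose_spec.choose)
        (isSome_germs _ (exists_germ X e).choose_spec.choose (Ultrafilter.le_nhds_lim (X := X.carrier) U))

theorem action_f_eq_iff {U : Ultrafilter X.carrier} {x : X.carrier} :
    (action X).f U = x ↔ (U : Filter X.carrier) ≤ 𝓝 x :=
  Ultrafilter.lim_eq_iff_le_nhds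

/-- Sections with the same germ at `x` agree near `x`, hence along every ultrafilter converging to
`x`; so the section chosen in `action` is immaterial. -/
theorem represents_germs {U : Ultrafilter X.carrier} {x : X.carrier}
    (hU : (U : Filter X.carrier) ≤ 𝓝 x) {W : Opens X.carrier} (hx : x ∈ W)
    (s : X.presheaf.obj (op W)) :
    Represents (action X) U x (X.presheaf.germ W x hx s) (germs W s) := by
  have h := action_f_eq_iff.2 hU
  refine ⟨h, ?_⟩
  subst h
  refine Germs.some_eq_ofPartial.2 (hU ?_)
  exact eventually_germs_eq (exists_germ X _).choose_spec.choose hx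
    (exists_germ X _).choose_spec.choose_spec.choose_spec

theorem eventually_eq_germs {U : Ultrafilter X.carrier} {x : X.carrier} {W : Opens X.carrier}
    {hx : x ∈ W} {s : X.presheaf.obj (op W)} {g}
    (h : Represents (action X) U x (X.presheaf.germ W x hx s) g) : ∀ᶠ y in U, g y = germs W s y :=
  h.unique (represents_germs (action_f_eq_iff.1 h.1) hx s)

theorem unitApp_comp_action : ultraproductUnitApp (stalks X) ≫ action X = 𝟙 _ := by
  refine (ultraproductUnitApp_comp_eq_id _).2
    ⟨fun x => action_f_eq_iff.2 (pure_le_nhds _), fun x e g h => ?_⟩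
  obtain ⟨W, hx, s, rfl⟩ := exists_germ X e
  have h' : g x = germs W s x := eventually_eq_germs h
  rw [h', germs_of_mem s hx]

theorem join_le_nhds {W : Ultrafilter (Ultrafilter X.carrier)} {x : X.carrier}
    (h : (W.map (action X).f : Filter X.carrier) ≤ 𝓝 x) :
    (Ultrafilter.join W : Filter X.carrier) ≤ 𝓝 x := by
  rw [le_nhds_iff] at h ⊢
  intro O hx hO
  have h' : ∀ᶠ U : Ultrafilter X.carrier in (W : Filter (Ultrafilter X.carrier)),
    (action X).f U ∈ O := h O hx hO
  refine Ultrafilter.eventually_join.2 ?_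
  filter_upwards [h'] with U hU
  exact (action_f_eq_iff.1 rfl) (hO.mem_nhds hU)

/-- One section near `x` represents its germ at `x` and also its germs at all nearby points, in
particular at the limits of almost all `U`. -/
theorem mulApp_comp_action :
    ultraproductMulApp (stalks X) ≫ action X = ultraproduct.{u}.map (action X) ≫ action X := by
  refine (ultraproductMulApp_comp_eq _).2 ⟨fun W => ?_, fun W x e g g' hg hg' => ?_⟩
  · exact action_f_eq_iff.2 (join_le_nhds (action_f_eq_iff.1 rfl))
  · obtain ⟨O, hx, s, rfl⟩ := exists_germ X e
    have h := Ultrafilter.eventually_join.1 (eventually_eq_germs hg)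
    have h' : ∀ᶠ U : Ultrafilter X.carrier in (W : Filter (Ultrafilter X.carrier)),
      g' ((action X).f U) = germs O s ((action X).f U) := eventually_eq_germs hg'
    filter_upwards [h, h'] with U hU hU' e' he'
    obtain ⟨hO, rfl⟩ := germs_eq_some (hU'.symm.trans he')
    exact (represents_germs (action_f_eq_iff.1 rfl) hO s).congr (hU.mono fun _ => Eq.symm)

theorem map_comp_action (m : X ⟶ Y) :
    ultraproduct.{u}.map (stalksMap m) ≫ action Y = action X ≫ stalksMap m := by
  have hc (U : Ultrafilter X.carrier) (x : X.carrier) (hU : (U : Filter X.carrier) ≤ 𝓝 x) :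
      (U.map (stalksMap m).f : Filter Y.carrier) ≤ 𝓝 ((stalksMap m).f x) :=
    (m.hom.base.hom.continuous.tendsto x).mono_left hU
  refine (ultraproduct_map_comp_eq _ _ _).2 ⟨fun U => ?_, fun U x y h e g hx hg => ?_⟩
  · exact action_f_eq_iff.2 (hc _ _ (action_f_eq_iff.1 rfl))
  · obtain ⟨O, hy, s, rfl⟩ := exists_germ Y e
    have hs := pull_congr (stalksMap m) (eventually_eq_germs hg)
    rw [fib_stalksMap_germ m x y h O hy s]
    rw [pull_stalksMap_germs] at hs
    exact (represents_germs (action_f_eq_iff.1 hx) _ _).congr (hs.mono fun _ => Eq.symm)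

end Action

end SetSpace

end SheafedSpace

/-! ### The functor from sheaves to algebras is fully faithful. -/

section Comparison

namespace SetSpace

variable {X Y Z : SetSpace.{u}}

theorem stalksMap_id : stalksMap (𝟙 X) = 𝟙 (stalks X) := by
  refine FamSet.hom_ext (fun _ => rfl) fun x y h h' e => ?_
  obtain rfl : x = y := h'
  obtain ⟨W, hx, s, rfl⟩ := exists_germ X e
  exact fib_stalksMap_germ (𝟙 X) x x h W hx s

theorem stalksMap_comp (m : X ⟶ Y) (n : Y ⟶ Z) :
    stalksMap (m ≫ n) = stalksMap m ≫ stalksMap n := by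
  refine FamSet.hom_ext (fun _ => rfl) fun x z h h' e => ?_
  obtain ⟨W, hz, s, rfl⟩ := exists_germ Z e
  rw [fib_comp (stalksMap m) (stalksMap n) x (m.hom.base x) z rfl h' h',
    fib_stalksMap_germ n (m.hom.base x) z h' W hz s, fib_stalksMap_germ m x (m.hom.base x) rfl]
  exact fib_stalksMap_germ (m ≫ n) x z h W hz s

theorem section_ext {O : Opens X.carrier} {s t : X.presheaf.obj (op O)}
    (h : ∀ x (hx : x ∈ O), X.presheaf.germ O x hx s = X.presheaf.germ O x hx t) : s = t :=
  TopCat.Presheaf.section_ext X.sheaf O s t h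

theorem stalksMap_injective {m n : X ⟶ Y} (h : stalksMap m = stalksMap n) : m = n := by
  obtain ⟨⟨f, c⟩⟩ := m
  obtain ⟨⟨f', c'⟩⟩ := n
  obtain rfl : f = f' := ConcreteCategory.hom_ext _ _ fun x => f_congr h x
  congr
  ext W s
  refine section_ext fun x hx => ?_
  have k := fib_congr h x (f x) rfl rfl (Y.presheaf.germ W (f x) hx s)
  exact ((fib_stalksMap_germ _ x (f x) rfl W hx s).symm.trans k).trans
    (fib_stalksMap_germ _ x (f x) rfl W hx s)

theorem exists_section {O : Opens X.carrier} {g : ∀ y, Option (X.presheaf.stalk y)}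
    (h : ∀ x ∈ O, ∃ (V : Opens X.carrier) (_ : x ∈ V) (t : X.presheaf.obj (op V)),
      ∀ᶠ y in 𝓝 x, g y = germs V t y) :
    ∃ t : X.presheaf.obj (op O), ∀ y ∈ O, g y = germs O t y := by
  have h' (x : O) : ∃ (V : Opens X.carrier) (_ : x.1 ∈ V) (_ : V ≤ O) (t : X.presheaf.obj (op V)),
      ∀ y ∈ V, g y = germs V t y := by
    obtain ⟨V, hx, t, ht⟩ := h x.1 x.2
    obtain ⟨N, hN, hNo, hxN⟩ := eventually_nhds_iff.1 ht
    let V' : Opens X.carrier := ⟨N, hNo⟩ ⊓ V ⊓ O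
    have i : V' ≤ V := inf_le_left.trans inf_le_right
    refine ⟨V', ⟨⟨hxN, hx⟩, x.2⟩, inf_le_right, X.presheaf.map (homOfLE i).op t, fun y hy => ?_⟩
    rw [hN y hy.1.1, germs_of_mem _ hy, germs_of_mem _ (i hy), X.presheaf.germ_res_apply]
  choose V hxV hV t ht using h'
  have hcomp : TopCat.Presheaf.IsCompatible X.presheaf V t := fun i j => by
    refine section_ext fun y hy => ?_
    rw [X.presheaf.germ_res_apply, X.presheaf.germ_res_apply]
    apply Option.some_injective
    rw [← germs_of_mem, ← germs_of_mem, ← ht i y hy.1, ← ht j y hy.2]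
  obtain ⟨s, hs, -⟩ := X.IsSheaf.isSheafUniqueGluing_types t hcomp
  have hO : O ≤ iSup V := fun y hy => Opens.mem_iSup.2 ⟨⟨y, hy⟩, hxV _⟩
  refine ⟨X.presheaf.map (homOfLE hO).op s, fun y hy => ?_⟩
  rw [ht ⟨y, hy⟩ y (hxV _), ← hs ⟨y, hy⟩, germs_of_mem _ hy, germs_of_mem _ (hxV _),
    X.presheaf.germ_res_apply, X.presheaf.germ_res_apply]

section Full

variable [CompactSpace X.carrier] [T2Space X.carrier] [CompactSpace Y.carrier] [T2Space Y.carrier]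

/-- The index map preserves limits of ultrafilters, so it is continuous. The pullback of a section
along `φ` is locally a section, hence glues to one. -/
theorem exists_map {φ : stalks X ⟶ stalks Y}
    (h : ultraproduct.{u}.map φ ≫ action Y = action X ≫ φ) : ∃ m : X ⟶ Y, stalksMap m = φ := by
  obtain ⟨h₁, h₂⟩ := (ultraproduct_map_comp_eq _ _ _).1 h
  let f : X.carrier → Y.carrier := φ.f
  have hf : Continuous f := by
    refine continuous_iff_ultrafilter.2 fun x U hU => ?_
    have k : (action Y).f (U.map f) = f x := (h₁ U).trans (congrArg f (action_f_eq_iff.2 hU))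
    exact action_f_eq_iff.1 k
  let F : X.carrier ⟶ Y.carrier := TopCat.ofHom ⟨f, hf⟩
  have key (W : Opens Y.carrier) (s : Y.presheaf.obj (op W)) :
      ∃ t : X.presheaf.obj (op ((Opens.map F).obj W)), ∀ x (hx : f x ∈ W),
        X.presheaf.germ ((Opens.map F).obj W) x hx t =
          fib φ x (f x) rfl (Y.presheaf.germ W (f x) hx s) := by
    have hp (x) (hx : f x ∈ W) : pull φ (germs W s) x =
        some (fib φ x (f x) rfl (Y.presheaf.germ W (f x) hx s)) := by
      have k : germs W s (φ.f x) = _ := germs_of_mem s hx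
      rw [pull, k]
      rfl
    obtain ⟨t, ht⟩ := exists_section (X := X) (O := (Opens.map F).obj W) (g := pull φ (germs W s))
      fun x hx => by
        obtain ⟨V, hxV, t, ht⟩ := exists_germ X (fib φ x (f x) rfl (Y.presheaf.germ W (f x) hx s))
        -- Along each ultrafilter converging to `x`, the pulled-back section and `t` represent the
        -- same element, so they agree near `x`.
        refine ⟨V, hxV, t, mem_iff_ultrafilter.2 fun U hU => ?_⟩
        have hfU : (U.map f : Filter Y.carrier) ≤ 𝓝 (f x) := (hf.tendsto x).mono_left hU
        exact (h₂ U x (f x) rfl _ _ (action_f_eq_iff.2 hU) (represents_germs hfU hx s)).unique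
          (ht ▸ represents_germs hU hxV t)
    refine ⟨t, fun x hx => Option.some_injective _ ?_⟩
    exact (germs_of_mem (W := (Opens.map F).obj W) t hx).symm.trans ((ht x hx).symm.trans (hp x hx))
  choose c hc using key
  let m : X ⟶ Y := InducedCategory.homMk
    { base := F
      c :=
        { app := fun W => ↾(c W.unop)
          naturality := fun W W' i => by
            ext s
            refine section_ext fun x hx => ?_
            refine (hc W'.unop _ x hx).trans (Eq.trans ?_
              (X.presheaf.germ_res_apply ((Opens.map F).map i.unop) x hx _).symm)
            refine (congrArg (fib φ x (f x) rfl)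
              (Y.presheaf.germ_res_apply i.unop (f x) hx s)).trans ?_
            exact (hc W.unop s x (i.unop.le hx)).symm } }
  refine ⟨m, FamSet.hom_ext (fun _ => rfl) fun x y hm hφ e => ?_⟩
  obtain ⟨W, hy, s, rfl⟩ := exists_germ Y e
  rw [fib_stalksMap_germ m x y hm W hy s]
  obtain rfl : f x = y := hφ
  exact hc W s x hy

end Full

end SetSpace

open SetSpace

instance (X : CHSheaf.{u}) : CompactSpace X.obj.carrier := X.property.1

instance (X : CHSheaf.{u}) : T2Space X.obj.carrier := X.property.2

/-- The functor from sheaves on compact Hausdorff spaces to algebras for the ultraproduct monad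
that sends a sheaf to the family of its stalks. -/
noncomputable def stalksAlgebra : CHSheaf.{u} ⥤ ultraproductMonad.{u}.Algebra where
  obj X :=
    { A := stalks X.obj
      a := action X.obj
      unit := (congrArg (· ≫ action X.obj) (codensityUnit_ultraproduct_app _)).trans
        unitApp_comp_action
      assoc := (congrArg (· ≫ action X.obj) (codensityMul_ultraproduct_app _)).trans
        mulApp_comp_action }
  map m := { f := stalksMap m.hom, h := map_comp_action m.hom }
  map_id _ := Monad.Algebra.Hom.ext stalksMap_id
  map_comp m n := Monad.Algebra.Hom.ext (stalksMap_comp m.hom n.hom)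

instance : stalksAlgebra.{u}.Faithful where
  map_injective h := ObjectProperty.hom_ext _ (stalksMap_injective (congrArg Monad.Algebra.Hom.f h))

instance : stalksAlgebra.{u}.Full where
  map_surjective {X Y} φ := by
    obtain ⟨m, hm⟩ := exists_map (X := X.obj) (Y := Y.obj) φ.h
    exact ⟨ObjectProperty.homMk m, Monad.Algebra.Hom.ext hm⟩

end Comparison

/-! ### Every algebra is the algebra of stalks of a sheaf. -/

section EssSurj

/-- The laws of an algebra for the ultraproduct monad, and a topology whose convergence is given by
its action on points. -/
structure IsTopologicalAlgebra {A : FamSet.{u}} [TopologicalSpace A.I]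
    (a : ultraproduct.{u}.obj A ⟶ A) : Prop where
  f_eq_iff (U : Ultrafilter A.I) (x : A.I) : a.f U = x ↔ (U : Filter A.I) ≤ 𝓝 x
  unit (x : A.I) (e : A.Fib x) (g : ∀ y, Option (A.Fib y)) :
    Represents a (pure x) x e g → g x = some e
  f_join (W : Ultrafilter (Ultrafilter A.I)) : a.f (Ultrafilter.join W) = a.f (W.map a.f)
  join (W : Ultrafilter (Ultrafilter A.I)) (x : A.I) (e : A.Fib x) (g g' : ∀ y, Option (A.Fib y)) :
    Represents a (Ultrafilter.join W) x e g → Represents a (W.map a.f) x e g' →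
      ∀ᶠ U : Ultrafilter A.I in (W : Filter (Ultrafilter A.I)), ∀ e', g' (a.f U) = some e' →
        Represents a U (a.f U) e' g

namespace IsTopologicalAlgebra

variable {A : FamSet.{u}} [TopologicalSpace A.I] {a : ultraproduct.{u}.obj A ⟶ A}
  (H : IsTopologicalAlgebra a) {x : A.I}

include H

/-- Representing `e` is an open condition among the ultrafilters converging to `x`. If `U` were a
limit of exceptions, it would be the join of some `W` concentrated on exceptions, and `W` is pushed
by `a` to the principal ultrafilter at `x`. Associativity then makes `g` represent `e` along almost
all of these exceptions. -/
theorem exists_mem_forall_represents {e : A.Fib x} {U : Ultrafilter A.I}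
    {g : ∀ y, Option (A.Fib y)} (hg : Represents a U x e g) :
    ∃ P ∈ U, ∀ U' : Ultrafilter A.I, (U' : Filter A.I) ≤ 𝓝 x → P ∈ U' → Represents a U' x e g := by
  let S : Set (Ultrafilter A.I) := {U' | a.f U' = x ∧ ¬ Represents a U' x e g}
  have hS : U ∉ closure S := fun hU => by
    obtain ⟨W, hSW, hW⟩ := mem_closure_iff_ultrafilter.1 hU
    have hj : U = Ultrafilter.join W := ultrafilter_converges_iff.1 hW
    have hp : W.map a.f = pure x := by
      refine Ultrafilter.coe_le_coe.1 ?_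
      rw [Ultrafilter.coe_pure, le_pure_iff]
      change a.f ⁻¹' {x} ∈ (W : Filter (Ultrafilter A.I))
      exact mem_of_superset hSW fun _ hU' => hU'.1
    obtain ⟨g₀, hg₀⟩ := Represents.exists_of_eq (a := a) (U := pure x)
      ((H.f_eq_iff _ _).2 (pure_le_nhds x)) e
    subst hj
    have h := H.join W x e g g₀ hg (hp ▸ hg₀)
    obtain ⟨U', hU', rfl, h'⟩ := (h.and hSW).exists
    exact h' (hU' e (H.unit _ e g₀ hg₀))
  obtain ⟨N, ⟨P, rfl⟩, hP, hN⟩ := (ultrafilterBasis_is_basis (α := A.I)).mem_nhds_iff.1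
    (isClosed_closure.isOpen_compl.mem_nhds hS)
  exact ⟨P, hP, fun U' hU' hPU' => by_contra fun h =>
    hN hPU' (subset_closure ⟨(H.f_eq_iff _ _).2 hU', h⟩)⟩

theorem exists_forall_represents (e : A.Fib x) :
    ∃ g, ∀ U : Ultrafilter A.I, (U : Filter A.I) ≤ 𝓝 x → Represents a U x e g := by
  classical
  let K : Set (Ultrafilter A.I) := {U | (U : Filter A.I) ≤ 𝓝 x}
  have hK : IsCompact K := by
    have h : K = ⋂ P ∈ 𝓝 x, {U : Ultrafilter A.I | P ∈ U} := by
      ext U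
      simp only [Set.mem_iInter]
      rfl
    rw [h]
    exact (isClosed_biInter fun P _ => ultrafilter_isClosed_basic P).isCompact
  -- Compactness leaves finitely many pairs `(P, g)`. Two are merged by using `g` on `P` and `k` off
  -- `P`, as an ultrafilter containing `P ∪ Q` contains `P` or `Q`.
  obtain ⟨P, g, hP, hg⟩ := hK.induction_on
    (p := fun C => ∃ (P : Set A.I) (g : ∀ y, Option (A.Fib y)), (∀ U ∈ C, P ∈ U) ∧
      ∀ U : Ultrafilter A.I, (U : Filter A.I) ≤ 𝓝 x → P ∈ U → Represents a U x e g)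
    ⟨∅, fun _ => none, fun _ h => h.elim, fun U _ h => (U.empty_notMem h).elim⟩
    (fun C D hCD ⟨P, g, hP, hg⟩ => ⟨P, g, fun U hU => hP U (hCD hU), hg⟩)
    (fun C D ⟨P, g, hP, hg⟩ ⟨Q, k, hQ, hk⟩ => by
      refine ⟨P ∪ Q, fun y => if y ∈ P then g y else k y, fun U hU => ?_, fun U hU hPQ => ?_⟩
      · rcases hU with hU | hU
        · exact mem_of_superset (hP U hU) Set.subset_union_left
        · exact mem_of_superset (hQ U hU) Set.subset_union_right
      · by_cases h : P ∈ U
        · exact (hg U hU h).congr (by filter_upwards [h] with y hy; rw [if_pos hy])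
        · have hQ' : Q ∈ U := (Ultrafilter.union_mem_iff.1 hPQ).resolve_left h
          refine (hk U hU hQ').congr ?_
          filter_upwards [Ultrafilter.compl_mem_iff_notMem.2 h] with y hy
          rw [if_neg hy])
    (fun U hU => by
      obtain ⟨g, hg⟩ := Represents.exists_of_eq (a := a) ((H.f_eq_iff U x).2 hU) e
      obtain ⟨P, hP, h⟩ := H.exists_mem_forall_represents hg
      exact ⟨{U' | P ∈ U'}, mem_nhdsWithin_of_mem_nhds
        ((ultrafilter_isOpen_basic P).mem_nhds hP), P, g, fun _ h => h, h⟩)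
  exact ⟨g, fun U hU => hg U hU (hP U hU)⟩

theorem exists_local_section (e : A.Fib x) :
    ∃ g : ∀ y, Option (A.Fib y), g x = some e ∧ ∀ᶠ y in 𝓝 x, ∃ e', g y = some e' ∧
      ∀ U : Ultrafilter A.I, (U : Filter A.I) ≤ 𝓝 y → Represents a U y e' g := by
  obtain ⟨g, hg⟩ := H.exists_forall_represents e
  refine ⟨g, H.unit x e g (hg _ (pure_le_nhds x)), ?_⟩
  refine mem_iff_ultrafilter.2 fun V hV => ?_
  by_contra hD
  have hD : ∀ᶠ y in V, ¬ ∃ e', g y = some e' ∧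
      ∀ U : Ultrafilter A.I, (U : Filter A.I) ≤ 𝓝 y → Represents a U y e' g :=
    Ultrafilter.eventually_not.2 hD
  -- `F y` will be an ultrafilter converging to `y` along which `g` fails to represent its value at
  -- `y`, whenever one exists.
  have hU (y : A.I) : ∃ U : Ultrafilter A.I, (U : Filter A.I) ≤ 𝓝 y ∧
      ((∀ e', g y = some e' → Represents a U y e' g) → ∀ e', g y = some e' →
        ∀ U : Ultrafilter A.I, (U : Filter A.I) ≤ 𝓝 y → Represents a U y e' g) := by
    by_contra hc
    push Not at hc
    obtain ⟨_, e', h', U, hUy, hU⟩ := hc (pure y) (pure_le_nhds y)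
    exact hU ((hc U hUy).1 e' h')
  choose F hF hF' using hU
  have hFy (y : A.I) : a.f (F y) = y := (H.f_eq_iff _ _).2 (hF y)
  have hmap : (V.map F).map a.f = V := by
    rw [Ultrafilter.map_map]
    exact (congrArg (V.map ·) (funext hFy)).trans V.map_id
  have hjoin : a.f (Ultrafilter.join (V.map F)) = x := by
    rw [H.f_join, hmap]
    exact (H.f_eq_iff _ _).2 hV
  -- Both `V` and the join of `V.map F` converge to `x`, so the same `g` represents `e` along each
  -- and plays both roles in associativity.
  have h : ∀ᶠ y in V, ∀ e', g (a.f (F y)) = some e' → Represents a (F y) (a.f (F y)) e' g :=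
    H.join (V.map F) x e g g (hg _ ((H.f_eq_iff _ _).1 hjoin)) (hmap.symm ▸ hg V hV)
  obtain ⟨y, h₁, h₂, h₃⟩ := (h.and ((hg V hV).isSome.and hD)).exists
  rw [hFy] at h₁
  obtain ⟨e', he'⟩ := Option.isSome_iff_exists.1 h₂
  exact h₃ ⟨e', he', hF' y h₁ e' he'⟩

end IsTopologicalAlgebra

section Sheaf

/-- A section over an open set, extended to a partial section of the whole family. -/
noncomputable def extendSection {A : FamSet.{u}} [TopologicalSpace A.I] {O : Opens A.I}
    (s : ∀ y : O, A.Fib y.1) (y : A.I) : Option (A.Fib y) :=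
  open Classical in if h : y ∈ O then some (s ⟨y, h⟩) else none

theorem extendSection_of_mem {A : FamSet.{u}} [TopologicalSpace A.I] {O : Opens A.I}
    (s : ∀ y : O, A.Fib y.1) {y : A.I} (h : y ∈ O) : extendSection s y = some (s ⟨y, h⟩) :=
  dif_pos h

variable {A : FamSet.{u}} [TopologicalSpace A.I] (a : ultraproduct.{u}.obj A ⟶ A)

/-- The families of elements over an open set that the action of ultrafilters recognizes as
continuous. -/
def continuousPredicate : TopCat.LocalPredicate (X := TopCat.of A.I) A.Fib where
  pred {O} s := ∀ (x : O) (U : Ultrafilter A.I), (U : Filter A.I) ≤ 𝓝 x.1 →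
    Represents a U x.1 (s x) (extendSection (O := O) s)
  res {O O'} i s h x U hU := by
    refine (h ⟨x.1, i.le x.2⟩ U hU).congr ?_
    filter_upwards [hU (O.isOpen.mem_nhds x.2)] with y hy
    exact (extendSection_of_mem (O := O') s (i.le hy)).trans
      (extendSection_of_mem (O := O) (fun y => s ⟨y.1, i.le y.2⟩) hy).symm
  locality {O} s h x U hU := by
    obtain ⟨V, hxV, i, hV⟩ := h x
    refine (hV ⟨x, hxV⟩ U hU).congr ?_
    filter_upwards [hU (V.isOpen.mem_nhds hxV)] with y hy
    exact (extendSection_of_mem (O := V) (fun y => s ⟨y.1, i.le y.2⟩) hy).trans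
      (extendSection_of_mem (O := O) s (i.le hy)).symm

/-- The sheafed space of an algebra for the ultraproduct monad. -/
noncomputable def algebraSpace : SetSpace.{u} where
  carrier := TopCat.of A.I
  presheaf := (TopCat.subsheafToTypes (continuousPredicate a)).presheaf
  IsSheaf := (TopCat.subsheafToTypes (continuousPredicate a)).property

/-- The map from a family with an algebra structure to the stalks of its sheaf. -/
noncomputable def toStalks : A ⟶ SetSpace.stalks (algebraSpace a) :=
  homMk (B := SetSpace.stalks (algebraSpace a)) id fun x =>
    TopCat.stalkToFiber (continuousPredicate a) x

variable {a}

theorem fib_toStalks_germ {x : A.I} {O : Opens (algebraSpace a).carrier} (hx : x ∈ O)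
    (s : (algebraSpace a).presheaf.obj (op O)) :
    fib (toStalks a) x x rfl ((algebraSpace a).presheaf.germ O x hx s) = s.1 ⟨x, hx⟩ :=
  TopCat.stalkToFiber_germ (continuousPredicate a) O x hx s

/-- Two continuous sections with the same value at `x` represent it along every ultrafilter
converging to `x`, so they agree near `x`. -/
theorem stalkToFiber_injective (x : A.I) :
    Function.Injective (TopCat.stalkToFiber (continuousPredicate a) x) := by
  refine TopCat.stalkToFiber_injective _ _ fun O O' s hs s' hs' h => ?_
  have h' : ∀ᶠ y in 𝓝 x, extendSection (O := O.1) s y = extendSection (O := O'.1) s' y :=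
    mem_iff_ultrafilter.2 fun U hU => (hs ⟨x, O.2⟩ U hU).unique (h ▸ hs' ⟨x, O'.2⟩ U hU)
  obtain ⟨N, hN, hNo, hxN⟩ := eventually_nhds_iff.1 h'
  let W : OpenNhds (X := TopCat.of A.I) x := ⟨⟨N, hNo⟩ ⊓ O.1 ⊓ O'.1, ⟨hxN, O.2⟩, O'.2⟩
  refine ⟨W, homOfLE fun y hy => hy.1.2, homOfLE fun y hy => hy.2, fun w => ?_⟩
  have k := hN w.1 w.2.1.1
  rw [extendSection_of_mem (O := O.1) s w.2.1.2, extendSection_of_mem (O := O'.1) s' w.2.2] at k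
  exact Option.some_injective _ k

namespace IsTopologicalAlgebra

variable (H : IsTopologicalAlgebra a)

include H

theorem stalkToFiber_surjective (x : A.I) :
    Function.Surjective (TopCat.stalkToFiber (continuousPredicate a) x) := by
  refine TopCat.stalkToFiber_surjective _ _ fun e => ?_
  obtain ⟨g, hgx, hg⟩ := H.exists_local_section e
  obtain ⟨N, hN, hNo, hxN⟩ := eventually_nhds_iff.1 hg
  choose s hs hs' using hN
  refine ⟨⟨⟨N, hNo⟩, hxN⟩, fun y => s y.1 y.2, fun y U hU => ?_, ?_⟩
  · refine (hs' y.1 y.2 U hU).congr ?_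
    filter_upwards [hU (hNo.mem_nhds y.2)] with y hy
    rw [hs y hy]
    exact (extendSection_of_mem (O := ⟨N, hNo⟩) (fun y => s y.1 y.2) hy).symm
  · exact Option.some_injective _ ((hs x hxN).symm.trans hgx)

theorem isIso_toStalks : IsIso (toStalks a) :=
  FamSet.isIso_of_bijective _ Function.bijective_id fun x =>
    ⟨stalkToFiber_injective x, H.stalkToFiber_surjective x⟩

/-- By the definition of the sheaf, a section represents its own values for `a`; its germs represent
the corresponding stalk elements for the action on stalks. -/
theorem map_toStalks_comp_action [CompactSpace (algebraSpace a).carrier]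
    [T2Space (algebraSpace a).carrier] :
    ultraproduct.{u}.map (toStalks a) ≫ SetSpace.action (algebraSpace a) = a ≫ toStalks a := by
  refine (ultraproduct_map_comp_eq _ _ _).2 ⟨fun U => ?_, fun U x y h e g hx hg => ?_⟩
  · refine SetSpace.action_f_eq_iff.2 (((H.f_eq_iff U _).1 rfl).trans' (le_of_eq ?_))
    exact congrArg _ (Ultrafilter.map_id U)
  · obtain rfl : x = y := h
    obtain ⟨O, hO, s, rfl⟩ := SetSpace.exists_germ (algebraSpace a) e
    rw [fib_toStalks_germ hO s]
    have hU := (H.f_eq_iff U x).1 hx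
    refine (s.2 ⟨x, hO⟩ U hU).congr ?_
    have h := pull_congr (toStalks a) (SetSpace.eventually_eq_germs hg)
    filter_upwards [h, hU (O.isOpen.mem_nhds hO)] with y hy hyO
    rw [hy]
    refine (extendSection_of_mem (O := O) s.1 hyO).trans ?_
    have k : SetSpace.germs O s ((toStalks a).f y) = _ := SetSpace.germs_of_mem s hyO
    rw [pull, k]
    exact congrArg some (fib_toStalks_germ hyO s).symm

end IsTopologicalAlgebra

end Sheaf

theorem Compactum.exists_topologicalSpace (C : Compactum.{u}) :
    ∃ _ : TopologicalSpace C, CompactSpace C ∧ T2Space C ∧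
      ∀ (U : Ultrafilter C) (x : C), C.str U = x ↔ (U : Filter C) ≤ 𝓝 x :=
  ⟨inferInstance, inferInstance, inferInstance, fun U x =>
    ⟨Compactum.le_nhds_of_str_eq U x, Compactum.str_eq_of_le_nhds U x⟩⟩

/-- An algebra for the ultrafilter monad is given by convergence in a compact Hausdorff space. -/
theorem exists_topologicalSpace_of_algebra {X : Type u} (str : Ultrafilter X → X)
    (h₁ : ∀ x, str (pure x) = x)
    (h₂ : ∀ W : Ultrafilter (Ultrafilter X), str (Ultrafilter.join W) = str (W.map str)) :
    ∃ _ : TopologicalSpace X, CompactSpace X ∧ T2Space X ∧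
      ∀ (U : Ultrafilter X) (x : X), str U = x ↔ (U : Filter X) ≤ 𝓝 x := by
  exact Compactum.exists_topologicalSpace
    (show Monad.Algebra (ofTypeMonad Ultrafilter) from
      { A := X
        a := ↾str
        unit := by ext x; exact h₁ x
        assoc := by ext W; exact h₂ W })

instance : stalksAlgebra.{u}.EssSurj where
  mem_essImage M := by
    let a : ultraproduct.{u}.obj M.A ⟶ M.A := M.a
    obtain ⟨h₁, h₂⟩ := (ultraproductUnitApp_comp_eq_id a).1
      ((congrArg (· ≫ a) (codensityUnit_ultraproduct_app M.A).symm).trans M.unit)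
    obtain ⟨h₃, h₄⟩ := (ultraproductMulApp_comp_eq a).1
      ((congrArg (· ≫ a) (codensityMul_ultraproduct_app M.A).symm).trans M.assoc)
    obtain ⟨t, hc, h2, hlim⟩ := exists_topologicalSpace_of_algebra a.f h₁ h₃
    have H : IsTopologicalAlgebra a :=
      { f_eq_iff := hlim
        unit := h₂
        f_join := h₃
        join := h₄ }
    have : CompactSpace (algebraSpace a).carrier := hc
    have : T2Space (algebraSpace a).carrier := h2
    let X : CHSheaf.{u} := ⟨algebraSpace a, inferInstance, inferInstance⟩
    let φ : M ⟶ stalksAlgebra.{u}.obj X := { f := toStalks a, h := H.map_toStalks_comp_action }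
    have : IsIso φ.f := H.isIso_toStalks
    have : IsIso φ := Monad.algebra_iso_of_iso _ φ
    exact ⟨X, ⟨(asIso φ).symm⟩⟩

instance : stalksAlgebra.{u}.IsEquivalence where

end EssSurj

/-- The inclusion of `FinFam(Set)` into `Fam(Set)` has a codensity monad, and the category of
algebras for it is equivalent to `CHSheaf`. -/
theorem mainTheorem8 :
    ∃ _ : HasCodensityMonad finFamInclusion.{u},
      Nonempty ((codensityMonad finFamInclusion.{u}).Algebra ≌ CHSheaf.{u}) :=
  -- The codensity monad and the ultraproduct monad come from two right Kan extensions of the same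
  -- functor along itself, so they are isomorphic monads.
  ⟨inferInstance, ⟨(Monad.algebraEquivOfIsoMonads (codensityMonadOfIso _ _ _ _)).trans
    stalksAlgebra.{u}.asEquivalence.symm⟩⟩
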